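/- **Conventions.** A category is *coherent* if it is regular (finite limits, pullback-stable image factorizations) and every finite family of subobjects of an object (including the empty family) has a union, stable under pullback. It is *$\aleph_1$-geometric* if it is regular and all countable families of subobjects have pullback-stable unions. A functor is *coherent* if it preserves finite limits, effective epimorphisms and finite unions of subobjects. For a subobject $\varphi$ of $x$ we write $M\varphi$ for its image as a subobject of $Mx$, and $\emptyset$ for the least subobject. An object is an *atom* if it has exactly two subobjects; a category is *2-valued* if its terminal object $1$ is an atom. A *filtration* of a coherent category $\mathcal C$ is a set $\mathbb S$ of objects (*sorts*) together with a specified monomorphism $\iota_x\colon x\hookrightarrow s_{x,1}\times\dots\times s_{x,n_x}$ ($n_x\ge 0$, all $s_{x,k}\in\mathbb S$) for every object $x$, such that every monomorphism $j\colon a\hookrightarrow s_1\times\dots\times s_n$ into a finite product of sorts is identified with some $\iota_{a'}$ by an isomorphism $a\cong a'$ and a reordering of the factors. An *$x$-type* is a prime filter of the lattice $\mathrm{Sub}_{\mathcal C}(x)$; the $x$-types form the space $S_{\mathcal C}(x)$, with basic open sets $[\varphi]=\{p:\varphi\in p\}$. An arrow $f\colon x\to y$ induces $S_{\mathcal C}(f)\colon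 S_{\mathcal C}(x)\to S_{\mathcal C}(y)$ by inverse image along $f^*$. For a list $\overline{\mathbb S}=(s_i)_{i\in I}$ of objects, the space $S^\omega_{\mathcal C}(\overline{\mathbb S})$ of *$\omega$-types* is the limit of the spaces $S_{\mathcal C}(\prod_{i\in X}s_i)$ over finite $X\subseteq I$ and the projections; $q_X$ denotes the component of $q$ at $X$. Let $M\colon\mathcal C\to\mathcal D$ be a coherent functor. * An $x$-type $p$ is *strongly realized* by $M$ if there is an atom $a\le Mx$ such that for all $\varphi\le x$: $\varphi\in p\iff M\varphi\cap a\ne\emptyset$. Otherwise $p$ is *weakly omitted*. * An $\omega$-type $q$ is *strongly realized* by $M$ if there are atoms $c_i\le M(s_i)$ ($i\in I$) such that for every finite $X\subseteq I$ and every $\varphi\le\prod_{i\in X}s_i$ $$\prod_{i\in X}c_i\cap M\varphi\neq\emptyset\iff\prod_{i\in X}c_i\le M\varphi\iff\varphi\in q_X .$$ * $M$ is *positively closed* if for every object $x$ and every $\varphi\le x$, $Mx$ is the union of $M\varphi$ and of all $M\psi$ with $\psi\le x$, $\psi\cap\varphi=\emptyset$. **Theorem.** Let $\mathcal C$ be a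 countable coherent category with a filtration with set of sorts $\mathbb S$ such that $s\to 1$ is an effective epimorphism for every $s\in\mathbb S$, and let $\overline{\mathbb S}=(s_i)_{i\in I}$ be a countable list of elements of $\mathbb S$ in which every element of $\mathbb S$ occurs infinitely often. Let $\mathcal D$ be a 2-valued $\aleph_1$-geometric category. For every finite $X\subseteq I$ let $E_X\subseteq S_{\mathcal C}(\prod_{i\in X}s_i)$ be meagre. Then there is a comeagre set $A\subseteq S^\omega_{\mathcal C}(\overline{\mathbb S})$ such that, whenever some $q\in A$ is strongly realized by a coherent functor $M\colon\mathcal C\to\mathcal D$, there are a positively closed coherent functor $N\colon\mathcal C\to\mathcal D$ and a natural transformation $N\Rightarrow M$ with monic components, such that $N$ weakly omits every $p\in E_X$ for every finite $X\subseteq I$. -/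

import Mathlib

open CategoryTheory CategoryTheory.Limits Topology

universe u₁ v₁ u₂ v₂ w

noncomputable section

namespace PosModel

/-- A coherent category: a regular category (finite limits and pullback-stable image
factorizations) whose subobject posets have finite unions (in particular an empty union, the
least subobject), stable under pullback. -/
class CoherentCategory (C : Type u₁) [Category.{v₁} C] : Prop extends Regular C where
  exists_union : ∀ {x : C} (S : Set (Subobject x)), S.Finite →
    ∃ u : Subobject x, IsLUB S u ∧ ∀ {y : C} (f : y ⟶ x),
      IsLUB ((Subobject.pullback f).obj '' S) ((Subobject.pullback f).obj u)

/-- An `ℵ₁`-geometric category: a regular category whose subobject posets have all unions of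
fewer than `ℵ₁` (that is, countably many) subobjects, stable under pullback. -/
class AlephOneGeometricCategory (D : Type u₂) [Category.{v₂} D] : Prop extends Regular D where
  exists_union : ∀ {x : D} (S : Set (Subobject x)), S.Countable →
    ∃ u : Subobject x, IsLUB S u ∧ ∀ {y : D} (f : y ⟶ x),
      IsLUB ((Subobject.pullback f).obj '' S) ((Subobject.pullback f).obj u)

instance (D : Type u₂) [Category.{v₂} D] [AlephOneGeometricCategory D] : CoherentCategory D where
  exists_union S hS := AlephOneGeometricCategory.exists_union S hS.countable

variable {C : Type u₁} [Category.{v₁} C] {D : Type u₂} [Category.{v₂} D]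

/-- The empty (least) subobject, as a predicate. -/
def IsEmptySub {x : C} (a : Subobject x) : Prop := IsBot a

/-- An object is an atom if it has exactly two subobjects. -/
def IsAtomObject (a : C) : Prop := Nat.card (Subobject a) = 2

/-- A category with a terminal object is 2-valued if the terminal object is an atom. -/
def IsTwoValued (D : Type u₂) [Category.{v₂} D] [HasTerminal D] : Prop := IsAtomObject (⊤_ D)

/-- The image `M φ` of a subobject `φ` of `x`, as a subobject of `M x`. -/
def mapSub (M : C ⥤ D) [PreservesFiniteLimits M] {x : C} (φ : Subobject x) :
    Subobject (M.obj x) :=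
  Subobject.mk (M.map φ.arrow)

/-- A coherent functor preserves finite limits, effective epimorphisms, and finite unions of
subobjects. -/
class CoherentFunctor (M : C ⥤ D) : Prop extends
    PreservesFiniteLimits M, M.PreservesEffectiveEpis where
  map_union : ∀ {x : C} (S : Set (Subobject x)) (u : Subobject x), S.Finite →
    IsLUB S u → IsLUB (mapSub M '' S) (mapSub M u)

/-- A filtration of `C`: a set of objects (the sorts), and for every object `x` a specified
monomorphism `ι_x : x ⟶ s_{x,1} × ⋯ × s_{x,n_x}` into a finite product of sorts (given by its
components), such that every monomorphism `j : a ⟶ s₁ × ⋯ × sₙ` into a finite product of sorts is,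
up to an isomorphism `a ≅ a'` and a reordering of the factors, the specified monomorphism of some
object `a'`. -/
structure Filtration (C : Type u₁) [Category.{v₁} C] [HasFiniteProducts C] where
  sorts : Set C
  arity : C → ℕ
  sort : ∀ x : C, Fin (arity x) → C
  sort_mem : ∀ (x : C) (k : Fin (arity x)), sort x k ∈ sorts
  ι : ∀ (x : C) (k : Fin (arity x)), x ⟶ sort x k
  mono_ι : ∀ x : C, Mono (Pi.lift (ι x))
  exists_iso : ∀ {n : ℕ} (s : Fin n → C), (∀ k, s k ∈ sorts) →
    ∀ {a : C} (j : a ⟶ ∏ᶜ s), Mono j →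
      ∃ (a' : C) (e : a ≅ a') (r : Fin n ≃ Fin (arity a')) (h : ∀ k, sort a' (r k) = s k),
        ∀ k, e.hom ≫ ι a' (r k) ≫ eqToHom (h k) = j ≫ Pi.π s k

/-- An `x`-type over `C`: a (proper) prime filter of subobjects of `x`. -/
structure TypeSpace (x : C) where
  filter : Order.PFilter (Subobject x)
  isPrime : filter.IsPrime

namespace TypeSpace

instance {x : C} : Membership (Subobject x) (TypeSpace x) := ⟨fun p φ => φ ∈ p.filter⟩

/-- The basic open set `[φ]`. -/
def basicOpen {x : C} (φ : Subobject x) : Set (TypeSpace x) := {p | φ ∈ p}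

/-- The topology of the prime spectrum of the lattice of subobjects of `x`. -/
instance {x : C} : TopologicalSpace (TypeSpace x) :=
  TopologicalSpace.generateFrom (Set.range basicOpen)

/-- The map `S_C(f) : S_C(x) → S_C(y)` induced by `f : x ⟶ y`: inverse image along
`f^* : Sub(y) → Sub(x)`. -/
def map [CoherentCategory C] {x y : C} (f : x ⟶ y) (p : TypeSpace x) : TypeSpace y where
  filter := Order.IsPFilter.toPFilter (F := {ψ | (Subobject.pullback f).obj ψ ∈ p.filter}) (by
    refine Order.IsPFilter.of_def ⟨⊤, ?_⟩ ?_ ?_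
    · simp only [Set.mem_ofPred_eq, Subobject.pullback_top]
      obtain ⟨a, ha⟩ := p.filter.nonempty
      exact p.filter.mem_of_le le_top ha
    · intro a ha b hb
      refine ⟨a ⊓ b, ?_, inf_le_left, inf_le_right⟩
      simp only [Set.mem_ofPred_eq, Subobject.inf_pullback]
      exact Order.PFilter.inf_mem ha hb
    · intro a b hab ha
      exact p.filter.mem_of_le ((Subobject.pullback f).monotone hab) ha)
  isPrime := ⟨by
    have hp := p.isPrime.compl_ideal
    refine ⟨fun a b hba ha hb => ha ?_, ?_, ?_⟩
    · exact p.filter.mem_of_le ((Subobject.pullback f).monotone hba) hb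
    · obtain ⟨u, -, hu⟩ := CoherentCategory.exists_union (∅ : Set (Subobject y)) Set.finite_empty
      obtain ⟨z, hz⟩ := hp.Nonempty
      refine ⟨u, fun h => hz (p.filter.mem_of_le ?_ h)⟩
      exact (hu f).2 (by simp [upperBounds])
    · intro a ha b hb
      obtain ⟨u, h1, hu⟩ := CoherentCategory.exists_union ({a, b} : Set (Subobject y))
        (Set.toFinite _)
      obtain ⟨z, hz, haz, hbz⟩ := hp.Directed _ ha _ hb
      refine ⟨u, fun h => hz (p.filter.mem_of_le ?_ h), h1.1 (by simp), h1.1 (by simp)⟩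
      refine (hu f).2 ?_
      rintro _ ⟨c, hc, rfl⟩
      rcases hc with rfl | rfl
      · exact haz
      · exact hbz⟩

end TypeSpace

section OmegaTypes

variable {I : Type w} (σ : I → C)

/-- The finite product `∏_{i ∈ X} σ i` of a finite part of a list `σ` of objects. -/
abbrev finProd [HasFiniteProducts C] (X : Finset I) : C := ∏ᶜ fun i : X => σ i

/-- The projection `∏_{i ∈ X} σ i ⟶ ∏_{i ∈ Y} σ i` for `Y ⊆ X`. -/
def finProj [HasFiniteProducts C] {X Y : Finset I} (h : Y ⊆ X) : finProd σ X ⟶ finProd σ Y :=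
  Pi.lift fun i : Y => Pi.π (fun i : X => σ i) ⟨i, h i.2⟩

/-- The space of `ω`-types over the list `σ`: the limit, over the finite parts `X` of the list and
the projection maps, of the spaces `S_C(∏_{i ∈ X} σ i)`; it carries the limit topology
(the subspace topology inherited from the product). -/
abbrev OmegaType [CoherentCategory C] : Type _ :=
  {q : ∀ X : Finset I, TypeSpace (finProd σ X) //
    ∀ {X Y : Finset I} (h : Y ⊆ X), TypeSpace.map (finProj σ h) (q X) = q Y}

end OmegaTypes

/-- A coherent functor `N` is positively closed if for every subobject `φ` of `x` in `C`,
`N x` is the union of `N φ` and of all `N ψ` with `ψ ∩ φ` empty. -/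
def PositivelyClosed [CoherentCategory C] (N : C ⥤ D) [PreservesFiniteLimits N] : Prop :=
  ∀ {x : C} (φ : Subobject x),
    IsLUB ({mapSub N φ} ∪ {a | ∃ ψ : Subobject x, IsEmptySub (ψ ⊓ φ) ∧ a = mapSub N ψ}) ⊤

/-- An `x`-type `p` is strongly realized by `M` if there is a subobject `a` of `M x` which is an
atom, and such that `φ ∈ p` iff `M φ ∩ a` is nonempty. -/
def StronglyRealizes [HasPullbacks D] (M : C ⥤ D) [PreservesFiniteLimits M] {x : C}
    (p : TypeSpace x) : Prop :=
  ∃ a : Subobject (M.obj x), IsAtomObject (a : D) ∧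
    ∀ φ : Subobject x, φ ∈ p ↔ ¬ IsEmptySub (mapSub M φ ⊓ a)

/-- A type is weakly omitted if it is not strongly realized. -/
def WeaklyOmits [HasPullbacks D] (M : C ⥤ D) [PreservesFiniteLimits M] {x : C}
    (p : TypeSpace x) : Prop :=
  ¬ StronglyRealizes M p

/-- The product `∏_{i ∈ X} c i` of subobjects `c i` of `M (σ i)`, as a subobject of
`M (∏_{i ∈ X} σ i)`, that is, the intersection of the inverse images of the `c i` under the
projections. -/
def prodSub [HasFiniteProducts C] [HasPullbacks D] (M : C ⥤ D) {I : Type w} {σ : I → C}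
    (c : ∀ i, Subobject (M.obj (σ i))) (X : Finset I) : Subobject (M.obj (finProd σ X)) :=
  Finset.univ.inf fun i : X => (Subobject.pullback (M.map (Pi.π (fun i : X => σ i) i))).obj (c i)

/-- An `ω`-type `q` is strongly realized by `M` if there are subobjects `c i` of `M (σ i)`, each of
them an atom, such that for every finite part `X` of the list and every subobject `φ` of
`∏_{i ∈ X} σ i` the following are equivalent: `∏_{i ∈ X} c i` meets `M φ`; `∏_{i ∈ X} c i` is
contained in `M φ`; `φ` belongs to the component `q_X`. -/
def StronglyRealizesOmega [CoherentCategory C] [HasPullbacks D] (M : C ⥤ D)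
    [PreservesFiniteLimits M] {I : Type w} {σ : I → C} (q : OmegaType σ) : Prop :=
  ∃ c : ∀ i, Subobject (M.obj (σ i)), (∀ i, IsAtomObject (c i : D)) ∧
    ∀ (X : Finset I) (φ : Subobject (finProd σ X)),
      (¬ IsEmptySub (prodSub M c X ⊓ mapSub M φ) ↔ φ ∈ q.1 X) ∧
      (prodSub M c X ≤ mapSub M φ ↔ φ ∈ q.1 X)

end PosModel

end

/-! A generic `ω`-type is a Henkin-style description of a countable model. Genericity (`IsGeneric`)
means that `q` decides every subobject positively, names the value of each arrow into a listed sort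
by a fresh index, and gives no value of a partial map on its coordinates a type in `E`. These are
countably many requirements, and each can be met by refining an arbitrary non-null condition `v ⟶ ∏
σ i`; hence generic `ω`-types are comeagre (`mem_residual_of_forcing`, `residual_isGeneric`).
Refinability gives density because every nonempty subobject lies in some `ω`-type
(`exists_omegaType`), which uses that the sorts cover `1`.

Let `M` strongly realize a generic `q` by atoms `c i`. Some index `j ≠ i` satisfies `x_i = x_j`
according to `q`, so `c i × c j` lies on the diagonal. Therefore `c i` is subterminal and, `D` being
2-valued, a global point (`IsGeneric.subsingleton_hom`). Partial maps carry the resulting tuples of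
points to countably many named points of each `M x`, and `N x` is defined as their union.

By stability and 2-valuedness such unions behave like sets of points: intersecting their inverse
images along a jointly monic pair gives nothing beyond points
(`inf_pullback_pointUnion_le_of_jointly_mono`), and an atom below the union is one of the points
(`exists_point_of_isAtomObject`). The claims about `N` thus reduce to named points. They are
detected by jointly monic coordinates (finite limits), lift along covers by witnesses and the
filtration (effective epimorphisms), decide every subobject (positive closedness) and have types
outside `E` (omission). Unions are inherited from `M`, since `N φ` is the trace of `M φ` on `N x`.
-/

namespace PosModel

/-! ### Null objects, images and unions in a coherent category -/

section Subobjects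

variable {C : Type u₁} [Category.{v₁} C]

/-- An object is null if its only subobject is the whole object. -/
def IsNull (w : C) : Prop := IsBot (⊤ : Subobject w)

theorem le_iff_factors {x : C} {φ ψ : Subobject x} : φ ≤ ψ ↔ ψ.Factors φ.arrow :=
  ⟨fun h => Subobject.factors_of_le _ h (Subobject.factors_self φ), Subobject.le_of_factors⟩

theorem factors_mono {x w : C} {φ ψ : Subobject x} (h : φ ≤ ψ) {f : w ⟶ x} (hf : φ.Factors f) :
    ψ.Factors f :=
  Subobject.factors_of_le f h hf

theorem factors_top {x w : C} (f : w ⟶ x) : (⊤ : Subobject x).Factors f :=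
  Subobject.top_factors f

theorem eq_top_of_factors_id {x : C} {φ : Subobject x} (h : φ.Factors (𝟙 x)) : φ = ⊤ := by
  refine top_le_iff.1 (le_iff_factors.2 ?_)
  simpa using Subobject.factors_of_factors_right (⊤ : Subobject x).arrow h

theorem exists_lift {x w : C} {φ : Subobject x} {f : w ⟶ x} (h : φ.Factors f) :
    ∃ g : w ⟶ (φ : C), g ≫ φ.arrow = f :=
  ⟨φ.factorThru f h, by simp⟩

theorem factors_mk {x y w : C} (m : y ⟶ x) [Mono m] {f : w ⟶ x} :
    (Subobject.mk m).Factors f ↔ ∃ g : w ⟶ y, g ≫ m = f :=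
  Iff.rfl

theorem factors_of_comp_eq {x w v : C} {φ : Subobject x} {f : w ⟶ x} {g : v ⟶ x} (k : w ⟶ v)
    (h : φ.Factors g) (e : k ≫ g = f) : φ.Factors f :=
  e ▸ Subobject.factors_of_factors_right k h

theorem pullback_factors [HasPullbacks C] {x y w : C} (f : x ⟶ y) (φ : Subobject y) (g : w ⟶ x) :
    ((Subobject.pullback f).obj φ).Factors g ↔ φ.Factors (g ≫ f) :=
  pullback_factors_iff _ _ _

theorem pullback_arrow_le_iff [HasPullbacks C] {x : C} {a b t : Subobject x} :
    (Subobject.pullback a.arrow).obj b ≤ (Subobject.pullback a.arrow).obj t ↔ a ⊓ b ≤ t := by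
  constructor
  · intro h
    rw [le_iff_factors]
    have h1 : a.Factors (a ⊓ b).arrow := le_iff_factors.1 inf_le_left
    obtain ⟨g, hg⟩ := exists_lift h1
    rw [← hg, ← pullback_factors]
    refine factors_mono h ?_
    rw [pullback_factors, hg]
    exact le_iff_factors.1 inf_le_right
  · intro h
    rw [le_iff_factors, pullback_factors]
    refine factors_mono h ?_
    rw [Subobject.inf_factors]
    exact ⟨Subobject.factors_comp_arrow _, (pullback_factors _ _ _).1 (Subobject.factors_self _)⟩

variable [CoherentCategory C]

theorem exists_isBot (x : C) : ∃ u : Subobject x, IsBot u ∧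
    ∀ {y : C} (f : y ⟶ x), IsBot ((Subobject.pullback f).obj u) := by
  obtain ⟨u, h, hu⟩ := CoherentCategory.exists_union (∅ : Set (Subobject x)) Set.finite_empty
  exact ⟨u, by simpa using h, fun f => by simpa using hu f⟩

/-- The least subobject of `x` is all of `x`, so its pullback along `f` is at once least, by
stability, and the whole of `w`. -/
theorem IsNull.of_hom {w x : C} (f : w ⟶ x) (hx : IsNull x) : IsNull w := by
  obtain ⟨u, -, hu⟩ := exists_isBot x
  obtain rfl : u = ⊤ := le_antisymm le_top (hx u)
  simpa [Subobject.pullback_top] using! hu f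

/-- Emptiness depends only on the underlying object: a least `φ` pulled back along its own arrow is
the whole object, and stability makes that pullback least. -/
theorem isEmptySub_iff {x : C} {φ : Subobject x} : IsEmptySub φ ↔ IsNull (φ : C) := by
  constructor
  · intro h
    obtain ⟨u, hu, hu'⟩ := exists_isBot x
    obtain rfl : φ = u := le_antisymm (h u) (hu φ)
    have h1 := Subobject.pullback_self φ.arrow
    rw [Subobject.mk_arrow] at h1
    have h2 := hu' φ.arrow
    rwa [h1] at h2
  · intro h ψ
    rw [le_iff_factors]
    have h1 := eq_top_iff.2 (h ((Subobject.pullback φ.arrow).obj ψ))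
    have h2 : ((Subobject.pullback φ.arrow).obj ψ).Factors (𝟙 _) := h1 ▸ factors_top _
    simpa [pullback_factors] using h2

theorem IsNull.of_factors {x w : C} {φ : Subobject x} (hφ : IsEmptySub φ) {f : w ⟶ x}
    (h : φ.Factors f) : IsNull w :=
  (isEmptySub_iff.1 hφ).of_hom (φ.factorThru f h)

theorem IsNull.of_cover {w x : C} (e : w ⟶ x) [StrongEpi e] (hw : IsNull w) : IsNull x := by
  intro ψ
  have h1 := eq_top_iff.2 (hw ((Subobject.pullback e).obj ψ))
  have h2 : ((Subobject.pullback e).obj ψ).Factors (𝟙 _) := h1 ▸ factors_top _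
  rw [pullback_factors, Category.id_comp] at h2
  obtain ⟨g, hg⟩ := exists_lift h2
  have : IsIso ψ.arrow := ExtremalEpi.isIso (f := e) g ψ.arrow hg
  exact (Subobject.eq_top_of_isIso_arrow ψ).ge

theorem imageSubobject_le_iff {w x : C} (f : w ⟶ x) (ψ : Subobject x) :
    imageSubobject f ≤ ψ ↔ ψ.Factors f :=
  ⟨fun h => factors_mono h (factors_of_comp_eq (factorThruImageSubobject f)
      (Subobject.factors_self _) (imageSubobject_arrow_comp f)),
    fun h => imageSubobject_le f (ψ.factorThru f h) (by simp)⟩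

theorem imageSubobject_factors {w x : C} (f : w ⟶ x) : (imageSubobject f).Factors f :=
  (imageSubobject_le_iff f _).1 le_rfl

instance strongEpi_factorThruImageSubobject {w x : C} (f : w ⟶ x) :
    StrongEpi (factorThruImageSubobject f) := by
  dsimp [factorThruImageSubobject]
  exact strongEpi_comp _ _

theorem isEmptySub_imageSubobject {w x : C} (f : w ⟶ x) :
    IsEmptySub (imageSubobject f) ↔ IsNull w :=
  ⟨fun h => .of_factors h (imageSubobject_factors f),
    fun h => isEmptySub_iff.2 (h.of_cover (factorThruImageSubobject f))⟩

/-- Two arrows have disjoint images if their pullback is null. -/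
theorem isEmptySub_inf_imageSubobject {v w x : C} (f : v ⟶ x) (g : w ⟶ x)
    (h : IsNull (pullback f g)) : IsEmptySub (imageSubobject f ⊓ imageSubobject g) := by
  rw [isEmptySub_iff]
  obtain ⟨k, hk⟩ := exists_lift (φ := imageSubobject f)
    (f := (imageSubobject f ⊓ imageSubobject g).arrow) (le_iff_factors.1 inf_le_left)
  obtain ⟨l, hl⟩ := exists_lift (φ := imageSubobject g)
    (f := (imageSubobject f ⊓ imageSubobject g).arrow) (le_iff_factors.1 inf_le_right)
  -- Two successive covers of the intersection, pulled back from `v` and from `w`, give an object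
  -- mapping compatibly to both, hence to their null pullback.
  have e1 : StrongEpi (pullback.fst k (factorThruImageSubobject f)) := inferInstance
  have e2 : StrongEpi (pullback.fst (pullback.fst k (factorThruImageSubobject f) ≫ l)
    (factorThruImageSubobject g)) := inferInstance
  refine IsNull.of_cover (pullback.fst k (factorThruImageSubobject f)) ?_
  refine IsNull.of_cover (pullback.fst (pullback.fst k (factorThruImageSubobject f) ≫ l)
    (factorThruImageSubobject g)) ?_
  refine h.of_hom (pullback.lift (pullback.fst _ _ ≫ pullback.snd _ _) (pullback.snd _ _) ?_)
  have c1 := pullback.condition (f := k) (g := factorThruImageSubobject f)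
  have c2 := pullback.condition (f := pullback.fst k (factorThruImageSubobject f) ≫ l)
    (g := factorThruImageSubobject g)
  calc (pullback.fst _ _ ≫ pullback.snd _ _) ≫ f
      = pullback.fst _ _ ≫ (pullback.snd _ _ ≫ factorThruImageSubobject f) ≫
          (imageSubobject f).arrow := by simp
    _ = (pullback.fst _ _ ≫ pullback.fst _ _ ≫ l) ≫ (imageSubobject g).arrow := by
        rw [← c1]; simp [hk, hl]
    _ = pullback.snd _ _ ≫ g := by rw [c2]; simp

/-- Meeting with `a` is pulling back along `a.arrow`, so stability of a union is distributivity. -/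
theorem inf_le_of_isLUB {x : C} {S : Set (Subobject x)} {a u t : Subobject x}
    (hu : IsLUB ((Subobject.pullback a.arrow).obj '' S) ((Subobject.pullback a.arrow).obj u))
    (h : ∀ s ∈ S, a ⊓ s ≤ t) : a ⊓ u ≤ t := by
  rw [← pullback_arrow_le_iff]
  refine hu.2 ?_
  rintro _ ⟨s, hs, rfl⟩
  exact pullback_arrow_le_iff.2 (h s hs)

theorem exists_isLUB_pair {x : C} (a b : Subobject x) : ∃ u : Subobject x, IsLUB {a, b} u ∧
    ∀ {y : C} (f : y ⟶ x), IsLUB ((Subobject.pullback f).obj '' {a, b})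
      ((Subobject.pullback f).obj u) :=
  CoherentCategory.exists_union _ (Set.toFinite _)

/-- The union of two subobjects in a coherent category. -/
noncomputable def union {x : C} (a b : Subobject x) : Subobject x :=
  (exists_isLUB_pair a b).choose

theorem isLUB_union {x : C} (a b : Subobject x) : IsLUB {a, b} (union a b) :=
  (exists_isLUB_pair a b).choose_spec.1

theorem le_union_left {x : C} (a b : Subobject x) : a ≤ union a b := (isLUB_union a b).1 (by simp)

theorem le_union_right {x : C} (a b : Subobject x) : b ≤ union a b := (isLUB_union a b).1 (by simp)

theorem union_le {x : C} {a b c : Subobject x} (ha : a ≤ c) (hb : b ≤ c) : union a b ≤ c :=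
  (isLUB_union a b).2 (by rintro _ (rfl | rfl) <;> assumption)

theorem pullback_union {x y : C} (f : y ⟶ x) (a b : Subobject x) :
    (Subobject.pullback f).obj (union a b) =
      union ((Subobject.pullback f).obj a) ((Subobject.pullback f).obj b) := by
  have h := (exists_isLUB_pair a b).choose_spec.2 f
  rw [Set.image_pair] at h
  exact h.unique (isLUB_union _ _)

theorem inf_union_le {x : C} (a b c : Subobject x) : a ⊓ union b c ≤ union (a ⊓ b) (a ⊓ c) := by
  refine inf_le_of_isLUB ((exists_isLUB_pair b c).choose_spec.2 _) ?_
  rintro _ (rfl | rfl)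
  · exact le_union_left _ _
  · exact le_union_right _ _

/-- The distributive lattice of subobjects of an object of a coherent category. -/
@[reducible]
noncomputable def subobjectLattice (x : C) : DistribLattice (Subobject x) :=
  letI : Lattice (Subobject x) :=
    { (inferInstance : SemilatticeInf (Subobject x)) with
      sup := union
      le_sup_left := le_union_left
      le_sup_right := le_union_right
      sup_le := fun _ _ _ => union_le }
  DistribLattice.ofInfSupLe inf_union_le

end Subobjects

/-! ### Types, cylinders and existence of `ω`-types -/

section OmegaTypeSpace

variable {C : Type u₁} [Category.{v₁} C]

namespace TypeSpace

theorem mem_mono {x : C} {p : TypeSpace x} {φ ψ : Subobject x} (h : φ ≤ ψ) (hφ : φ ∈ p) : ψ ∈ p :=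
  p.filter.mem_of_le h hφ

theorem ext_mem {x : C} {p q : TypeSpace x} (h : ∀ φ, φ ∈ p ↔ φ ∈ q) : p = q := by
  obtain ⟨p, hp⟩ := p
  obtain ⟨q, hq⟩ := q
  congr
  exact SetLike.ext h

theorem top_mem {x : C} (p : TypeSpace x) : ⊤ ∈ p := by
  obtain ⟨a, ha⟩ := p.filter.nonempty
  exact mem_mono le_top ha

theorem not_isEmptySub_of_mem {x : C} {p : TypeSpace x} {φ : Subobject x} (hφ : φ ∈ p) :
    ¬ IsEmptySub φ := by
  intro h
  obtain ⟨a, ha⟩ := p.isPrime.compl_ideal.Nonempty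
  exact ha (mem_mono (h a) hφ)

theorem isOpen_basicOpen {x : C} (φ : Subobject x) : IsOpen (basicOpen φ) :=
  TopologicalSpace.isOpen_generateFrom_of_mem ⟨φ, rfl⟩

variable [CoherentCategory C]

theorem inf_mem {x : C} {p : TypeSpace x} {φ ψ : Subobject x} (hφ : φ ∈ p) (hψ : ψ ∈ p) :
    φ ⊓ ψ ∈ p :=
  Order.PFilter.inf_mem hφ hψ

theorem mem_map {x y : C} (f : x ⟶ y) (p : TypeSpace x) (φ : Subobject y) :
    φ ∈ map f p ↔ (Subobject.pullback f).obj φ ∈ p :=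
  Iff.rfl

/-- The type given by a prime filter of subobjects. -/
def ofPrimeFilter {x : C} (P : Set (Subobject x)) (h1 : ⊤ ∈ P) (h2 : ∀ a ∈ P, ∀ b ∈ P, a ⊓ b ∈ P)
    (h3 : ∀ a b, a ≤ b → a ∈ P → b ∈ P) (h4 : ∀ a, IsEmptySub a → a ∉ P)
    (h5 : ∀ a b, union a b ∈ P → a ∈ P ∨ b ∈ P) : TypeSpace x where
  filter := Order.IsPFilter.toPFilter (F := P) (.of_def ⟨_, h1⟩
    (fun a ha b hb => ⟨a ⊓ b, h2 a ha b hb, inf_le_left, inf_le_right⟩)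
    (fun hab ha => h3 _ _ hab ha))
  isPrime := ⟨by
    refine ⟨fun a b hba ha hb => ha (h3 _ _ hba hb), ?_, ?_⟩
    · obtain ⟨u, hu, -⟩ := exists_isBot x
      exact ⟨u, h4 u hu⟩
    · intro a ha b hb
      refine ⟨union a b, fun h => ?_, le_union_left a b, le_union_right a b⟩
      exact (h5 a b h).elim ha hb⟩

theorem mem_ofPrimeFilter {x : C} (P : Set (Subobject x)) (h1 h2 h3 h4 h5) (a : Subobject x) :
    a ∈ ofPrimeFilter P h1 h2 h3 h4 h5 ↔ a ∈ P :=
  Iff.rfl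

/-- Every open set of types contains a basic open set around each of its points. -/
theorem exists_basicOpen_subset {x : C} {U : Set (TypeSpace x)} (hU : IsOpen U) {p : TypeSpace x}
    (hp : p ∈ U) : ∃ φ, φ ∈ p ∧ basicOpen φ ⊆ U := by
  induction hU with
  | basic s hs =>
    obtain ⟨φ, rfl⟩ := hs
    exact ⟨φ, hp, subset_rfl⟩
  | univ => exact ⟨⊤, top_mem p, Set.subset_univ _⟩
  | inter s t _ _ ihs iht =>
    obtain ⟨φ, h1, h2⟩ := ihs hp.1
    obtain ⟨ψ, h3, h4⟩ := iht hp.2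
    exact ⟨φ ⊓ ψ, inf_mem h1 h3, fun r hr =>
      ⟨h2 (mem_mono inf_le_left hr), h4 (mem_mono inf_le_right hr)⟩⟩
  | sUnion S _ ih =>
    obtain ⟨s, hs, hp⟩ := hp
    obtain ⟨φ, h1, h2⟩ := ih s hs hp
    exact ⟨φ, h1, h2.trans (Set.subset_sUnion_of_mem hs)⟩

end TypeSpace

variable [CoherentCategory C] {I : Type w} {σ : I → C}

theorem finProj_π {X Y : Finset I} (h : Y ⊆ X) (i : I) (hi : i ∈ Y) :
    finProj σ h ≫ Pi.π (fun i : Y => σ i) ⟨i, hi⟩ = Pi.π (fun i : X => σ i) ⟨i, h hi⟩ := by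
  simp [finProj]

theorem finProj_comp {X Y Z : Finset I} (h : Y ⊆ X) (h' : Z ⊆ Y) :
    finProj σ h ≫ finProj σ h' = finProj σ (h'.trans h) := by
  refine Pi.hom_ext _ _ fun ⟨i, hi⟩ => ?_
  rw [Category.assoc, finProj_π, finProj_π, finProj_π]

theorem finProj_refl (X : Finset I) : finProj σ (subset_refl X) = 𝟙 _ := by
  refine Pi.hom_ext _ _ fun ⟨i, hi⟩ => ?_
  rw [finProj_π, Category.id_comp]

theorem pullback_finProj {X Y Z : Finset I} (h : Y ⊆ X) (h' : Z ⊆ Y)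
    (φ : Subobject (finProd σ Z)) :
    (Subobject.pullback (finProj σ h)).obj ((Subobject.pullback (finProj σ h')).obj φ) =
      (Subobject.pullback (finProj σ (h'.trans h))).obj φ := by
  rw [← finProj_comp h h', Subobject.pullback_comp]

theorem OmegaType.mem_iff (q : OmegaType σ) {X Y : Finset I} (h : Y ⊆ X)
    (φ : Subobject (finProd σ Y)) :
    (Subobject.pullback (finProj σ h)).obj φ ∈ q.1 X ↔ φ ∈ q.1 Y := by
  rw [← q.2 h, TypeSpace.mem_map]

/-- If all `σ i` cover the terminal object, every non-null object has a non-null object over it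
which has points in any given finite set of the `σ i`. -/
theorem exists_points (hσ : ∀ i, EffectiveEpi (terminal.from (σ i))) {w : C} (hw : ¬ IsNull w)
    (T : Finset I) : ∃ (w' : C) (_ : w' ⟶ w), ¬ IsNull w' ∧ ∀ i ∈ T, Nonempty (w' ⟶ σ i) := by
  classical
  induction T using Finset.induction_on with
  | empty => exact ⟨w, 𝟙 w, hw, by simp⟩
  | insert a T _ ih =>
    obtain ⟨w', u, h1, h2⟩ := ih
    have := hσ a
    have hp := IsPullback.of_hasBinaryProduct' w' (σ a)
    have : IsRegularEpi (terminal.from (σ a)) := inferInstance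
    have hr : IsRegularEpi (prod.fst : w' ⨯ σ a ⟶ w') :=
      Regular.regularEpiIsStableUnderBaseChange.of_isPullback hp.flip this
    refine ⟨w' ⨯ σ a, prod.fst ≫ u, fun h => h1 (h.of_cover prod.fst), fun i hi => ?_⟩
    obtain rfl | hi := Finset.mem_insert.1 hi
    · exact ⟨prod.snd⟩
    · exact (h2 i hi).map fun k => prod.fst ≫ k

theorem not_isEmptySub_pullback_finProj (hσ : ∀ i, EffectiveEpi (terminal.from (σ i)))
    {X Y : Finset I} (h : Y ⊆ X) {φ : Subobject (finProd σ Y)} (hφ : ¬ IsEmptySub φ) :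
    ¬ IsEmptySub ((Subobject.pullback (finProj σ h)).obj φ) := by
  classical
  rw [isEmptySub_iff] at hφ
  obtain ⟨w, u, hw, ht⟩ := exists_points hσ hφ X
  -- Coordinates in `Y` come from `φ`; the remaining ones are arbitrary and exist after passing to
  -- `w`.
  let t : w ⟶ finProd σ X := Pi.lift fun i =>
    if hi : (i : I) ∈ Y then u ≫ φ.arrow ≫ Pi.π (fun i : Y => σ i) ⟨i, hi⟩ else (ht i i.2).some
  have e : t ≫ finProj σ h = u ≫ φ.arrow := by
    refine Pi.hom_ext _ _ fun ⟨i, hi⟩ => ?_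
    rw [Category.assoc, finProj_π]
    simp [t, hi]
  refine fun hn => hw (.of_factors hn (f := t) ?_)
  rw [pullback_factors, e]
  exact Subobject.factors_comp_arrow u

/-- Every nonempty subobject of a finite product belongs to some `ω`-type. -/
theorem exists_omegaType (hσ : ∀ i, EffectiveEpi (terminal.from (σ i))) {Z : Finset I}
    {χ : Subobject (finProd σ Z)} (hχ : ¬ IsEmptySub χ) : ∃ q : OmegaType σ, χ ∈ q.1 Z := by
  classical
  let inst (Y : Finset I) : DistribLattice (Subobject (finProd σ Y)) := subobjectLattice _
  let bot (Y : Finset I) : Subobject (finProd σ Y) := (exists_isBot (finProd σ Y)).choose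
  have hbot (Y) : IsBot (bot Y) := (exists_isBot (finProd σ Y)).choose_spec.1
  -- One prime ideal must serve all finite products at once. The product lattice modulo eventually
  -- least families replaces the directed colimit of the lattices of subobjects; `emb X φ`
  -- represents the cylinder over `φ`, and its default value `bot` does not affect its class.
  let emb (X : Finset I) (φ : Subobject (finProd σ X)) : ∀ Y, Subobject (finProd σ Y) := fun Y =>
    if h : X ⊆ Y then (Subobject.pullback (finProj σ h)).obj φ else bot Y
  let N : Order.Ideal (∀ Y, Subobject (finProd σ Y)) := Order.IsIdeal.toIdeal
    (I := {f | ∃ Y₀ : Finset I, ∀ Y, Y₀ ⊆ Y → IsBot (f Y)}) (by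
      refine ⟨?_, ⟨bot, ∅, fun Y _ => hbot Y⟩, ?_⟩
      · rintro f g hgf ⟨Y₀, h⟩
        exact ⟨Y₀, fun Y hY b => (hgf Y).trans (h Y hY b)⟩
      · rintro f ⟨Y₀, hf⟩ g ⟨Y₁, hg⟩
        refine ⟨f ⊔ g, ⟨Y₀ ∪ Y₁, fun Y hY b => ?_⟩, le_sup_left, le_sup_right⟩
        exact sup_le (hf Y (Finset.union_subset_left hY) b) (hg Y (Finset.union_subset_right hY) b))
  have hN (f) : f ∈ N ↔ ∃ Y₀ : Finset I, ∀ Y, Y₀ ⊆ Y → IsBot (f Y) := Iff.rfl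
  have hdisj : Disjoint (Order.PFilter.principal (emb Z χ) : Set (∀ Y, Subobject (finProd σ Y)))
      (N : Set (∀ Y, Subobject (finProd σ Y))) := by
    rw [Set.disjoint_left]
    rintro f hf ⟨Y₀, h⟩
    have h1 : Z ⊆ Y₀ ∪ Z := Finset.subset_union_right
    have h2 : (Subobject.pullback (finProj σ h1)).obj χ ≤ f (Y₀ ∪ Z) := by
      have h3 := (Order.PFilter.mem_principal.1 hf) (Y₀ ∪ Z)
      simp only [emb, dif_pos h1] at h3
      exact h3
    exact not_isEmptySub_pullback_finProj hσ h1 hχ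
      fun b => h2.trans (h (Y₀ ∪ Z) Finset.subset_union_left b)
  obtain ⟨J, hJ, hNJ, hdJ⟩ := DistribLattice.prime_ideal_of_disjoint_filter_ideal hdisj
  -- As `J` contains the eventually least families, membership in `J` only depends on eventual
  -- values.
  have congrJ {f g : ∀ Y, Subobject (finProd σ Y)} (Y₀ : Finset I)
      (h : ∀ Y, Y₀ ⊆ Y → f Y ≤ g Y) (hg : g ∈ J) : f ∈ J := by
    let b : ∀ Y, Subobject (finProd σ Y) := fun Y => if Y₀ ⊆ Y then bot Y else f Y
    have hb : b ∈ J := hNJ ⟨Y₀, fun Y hY => by simpa [b, hY] using hbot Y⟩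
    refine J.lower ?_ (Order.Ideal.sup_mem hg hb)
    intro Y
    by_cases hY : Y₀ ⊆ Y
    · exact (h Y hY).trans (le_sup_left (a := g Y) (b := b Y))
    · have h1 : f Y ≤ b Y := by simp [b, hY]
      exact h1.trans (le_sup_right (a := g Y) (b := b Y))
  have emb_of {X Y : Finset I} (h : X ⊆ Y) (φ) :
      emb X φ Y = (Subobject.pullback (finProj σ h)).obj φ := by simp only [emb, dif_pos h]
  refine ⟨⟨fun X => TypeSpace.ofPrimeFilter {φ | emb X φ ∉ J} ?_ ?_ ?_ ?_ ?_, ?_⟩, ?_⟩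
  · intro h
    refine Set.disjoint_left.1 hdJ (Order.PFilter.mem_principal.2 (le_refl (emb Z χ)))
      (congrJ (X ∪ Z) (fun Y hY => ?_) h)
    rw [emb_of (Finset.union_subset_left hY), Subobject.pullback_top]
    exact le_top
  · intro a ha b hb h
    refine (Order.Ideal.IsPrime.mem_or_mem hJ (x := emb X a) (y := emb X b) ?_).elim ha hb
    refine congrJ X (fun Y hY => ?_) h
    rw [emb_of hY, Subobject.inf_pullback]
    change emb X a Y ⊓ emb X b Y ≤ _
    rw [emb_of hY, emb_of hY]
  · intro a b hab ha hb
    refine ha (congrJ X (fun Y hY => ?_) hb)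
    rw [emb_of hY, emb_of hY]
    exact (Subobject.pullback _).monotone hab
  · intro a ha h
    refine h (hNJ ⟨X, fun Y hY => ?_⟩)
    rw [emb_of hY]
    obtain ⟨u, hu, hu'⟩ := exists_isBot (finProd σ X)
    obtain rfl : a = u := le_antisymm (ha u) (hu a)
    exact hu' _
  · intro a b h
    by_contra! hab
    simp only [Set.mem_ofPred_eq, not_not] at hab
    refine h (congrJ X (fun Y hY => ?_) (Order.Ideal.sup_mem hab.1 hab.2))
    rw [emb_of hY, pullback_union, ← emb_of hY, ← emb_of hY]
    exact le_rfl
  · intro X Y h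
    refine TypeSpace.ext_mem fun φ => ?_
    rw [TypeSpace.mem_map, TypeSpace.mem_ofPrimeFilter, TypeSpace.mem_ofPrimeFilter]
    refine not_congr ⟨fun hm => congrJ X (fun W hW => ?_) hm,
      fun hm => congrJ X (fun W hW => ?_) hm⟩
    all_goals rw [emb_of hW, emb_of (h.trans hW), pullback_finProj]
  · rw [TypeSpace.mem_ofPrimeFilter]
    exact fun h => Set.disjoint_left.1 hdJ (Order.PFilter.mem_principal.2 (le_refl (emb Z χ))) h

end OmegaTypeSpace

/-! ### Genericity holds on a comeagre set -/

section Generic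

variable {C : Type u₁} [Category.{v₁} C] [CoherentCategory C] {I : Type w} {σ : I → C}

/-- Every nonempty subobject belongs to some type. -/
theorem exists_type {x : C} {χ : Subobject x} (hχ : ¬ IsEmptySub χ) : ∃ p : TypeSpace x, χ ∈ p := by
  let inst : DistribLattice (Subobject x) := subobjectLattice _
  obtain ⟨b, hb, -⟩ := exists_isBot x
  have hdisj : Disjoint (Order.PFilter.principal χ : Set (Subobject x))
      (Order.Ideal.principal b : Set (Subobject x)) := by
    rw [Set.disjoint_left]
    exact fun f hf hf' => hχ fun a =>
      ((Order.PFilter.mem_principal.1 hf).trans (Order.Ideal.mem_principal.1 hf')).trans (hb a)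
  obtain ⟨J, hJ, hbJ, hdJ⟩ := DistribLattice.prime_ideal_of_disjoint_filter_ideal hdisj
  have hχJ : χ ∉ J := fun h => Set.disjoint_left.1 hdJ (Order.PFilter.mem_principal.2 le_rfl) h
  refine ⟨TypeSpace.ofPrimeFilter {φ | φ ∉ J} ?_ ?_ ?_ ?_ ?_, hχJ⟩
  · exact fun h => hχJ (J.lower le_top h)
  · exact fun a ha c hc h => (Order.Ideal.IsPrime.mem_or_mem hJ h).elim ha hc
  · exact fun a c hac ha hc => ha (J.lower hac hc)
  · exact fun a ha h => h (hbJ (Order.Ideal.mem_principal.2 (ha b)))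
  · intro a c h
    by_contra! hac
    simp only [Set.mem_ofPred_eq, not_not] at hac
    exact h (Order.Ideal.sup_mem hac.1 hac.2)

/-- Every open set of `ω`-types contains a cylinder around each of its points. -/
theorem OmegaType.exists_cylinder_subset {U : Set (OmegaType σ)} (hU : IsOpen U) {q : OmegaType σ}
    (hq : q ∈ U) : ∃ (X : Finset I) (φ : Subobject (finProd σ X)), φ ∈ q.1 X ∧
      ∀ q' : OmegaType σ, φ ∈ q'.1 X → q' ∈ U := by
  classical
  -- The sets containing a cylinder around each of their points form a topology. It suffices that
  -- every limit-open set is open for it.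
  let T : TopologicalSpace (OmegaType σ) :=
    { IsOpen := fun U => ∀ q ∈ U, ∃ (X : Finset I) (φ : Subobject (finProd σ X)), φ ∈ q.1 X ∧
        ∀ q' : OmegaType σ, φ ∈ q'.1 X → q' ∈ U
      isOpen_univ := fun q _ => ⟨∅, ⊤, TypeSpace.top_mem _, fun _ _ => trivial⟩
      isOpen_inter := by
        intro U V hU hV q hq
        obtain ⟨X, φ, h1, h2⟩ := hU q hq.1
        obtain ⟨Y, ψ, h3, h4⟩ := hV q hq.2
        have hX : X ⊆ X ∪ Y := Finset.subset_union_left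
        have hY : Y ⊆ X ∪ Y := Finset.subset_union_right
        refine ⟨X ∪ Y, (Subobject.pullback (finProj σ hX)).obj φ ⊓
          (Subobject.pullback (finProj σ hY)).obj ψ,
          TypeSpace.inf_mem ((q.mem_iff hX φ).2 h1) ((q.mem_iff hY ψ).2 h3), fun q' hq' => ⟨?_, ?_⟩⟩
        · exact h2 q' ((q'.mem_iff hX φ).1 (TypeSpace.mem_mono inf_le_left hq'))
        · exact h4 q' ((q'.mem_iff hY ψ).1 (TypeSpace.mem_mono inf_le_right hq'))
      isOpen_sUnion := by
        rintro S hS q ⟨U, hU, hq⟩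
        obtain ⟨X, φ, h1, h2⟩ := hS U hU q hq
        exact ⟨X, φ, h1, fun q' hq' => ⟨U, hU, h2 q' hq'⟩⟩ }
  have hc : @Continuous _ _ T instTopologicalSpaceSubtype (id : OmegaType σ → OmegaType σ) := by
    refine continuous_induced_rng.2 (@continuous_pi _ _ _ T _ _ fun X =>
      continuous_generateFrom_iff.2 ?_)
    rintro _ ⟨φ, rfl⟩ q hq
    exact ⟨X, φ, hq, fun _ h => h⟩
  exact @IsOpen.preimage _ _ T instTopologicalSpaceSubtype _ hc _ hU q hq

theorem OmegaType.isOpen_cylinder (X : Finset I) (φ : Subobject (finProd σ X)) :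
    IsOpen {q : OmegaType σ | φ ∈ q.1 X} :=
  have h : Continuous fun q : OmegaType σ => q.1 X :=
    (continuous_apply X).comp continuous_subtype_val
  (TypeSpace.isOpen_basicOpen φ).preimage h

/-- A subobject through which `m ≫ π` factors belongs to every `ω`-type containing the image
of `m`. -/
theorem OmegaType.mem_of_factors (q : OmegaType σ) {X Y : Finset I} (h : Y ⊆ X) {v : C}
    {m : v ⟶ finProd σ X} (hm : imageSubobject m ∈ q.1 X) {φ : Subobject (finProd σ Y)}
    (hf : φ.Factors (m ≫ finProj σ h)) : φ ∈ q.1 Y := by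
  rw [← q.mem_iff h]
  exact TypeSpace.mem_mono ((imageSubobject_le_iff _ _).2 ((pullback_factors _ _ _).2 hf)) hm

/-- A set of `ω`-types is comeagre if every non-null condition can be refined to one which forces
membership in the set. -/
theorem mem_residual_of_forcing (hσ : ∀ i, EffectiveEpi (terminal.from (σ i)))
    {U : Set (OmegaType σ)} (Z : Finset I)
    (hU : ∀ (Y : Finset I) (_ : Z ⊆ Y) (v : C) (m : v ⟶ finProd σ Y), ¬ IsNull v →
      ∃ (Y' : Finset I) (hY' : Y ⊆ Y') (v' : C) (m' : v' ⟶ finProd σ Y') (u : v' ⟶ v),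
        ¬ IsNull v' ∧ m' ≫ finProj σ hY' = u ≫ m ∧
          ∀ q : OmegaType σ, imageSubobject m' ∈ q.1 Y' → q ∈ U) :
    U ∈ residual (OmegaType σ) := by
  classical
  refine Filter.mem_of_superset (residual_of_dense_open isOpen_interior ?_) interior_subset
  rw [dense_iff_inter_open]
  rintro O hO ⟨q, hq⟩
  obtain ⟨X, φ, hφ, hX⟩ := OmegaType.exists_cylinder_subset hO hq
  -- The refinement hypothesis only concerns finite sets containing `Z`, so the cylinder is first
  -- moved to `X ∪ Z`.
  have h1 : X ⊆ X ∪ Z := Finset.subset_union_left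
  have h2 := TypeSpace.not_isEmptySub_of_mem ((q.mem_iff h1 φ).2 hφ)
  rw [isEmptySub_iff] at h2
  obtain ⟨Y, hY, v, m, u, hv, hm, hmU⟩ := hU (X ∪ Z) Finset.subset_union_right _
    ((Subobject.pullback (finProj σ h1)).obj φ).arrow h2
  obtain ⟨r, hr⟩ := exists_omegaType hσ (fun h => hv ((isEmptySub_imageSubobject m).1 h))
  refine ⟨r, hX r ?_, ?_⟩
  · refine r.mem_of_factors (h1.trans hY) hr ?_
    rw [← finProj_comp hY h1, ← Category.assoc, hm, ← pullback_factors]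
    exact Subobject.factors_comp_arrow u
  · exact mem_interior.2 ⟨_, fun q hq => hmU q hq, OmegaType.isOpen_cylinder Y _, hr⟩

theorem OmegaType.not_isNull_pullback (q : OmegaType σ) {X : Finset I} {v v' : C}
    {m : v ⟶ finProd σ X} {m' : v' ⟶ finProd σ X} (h : imageSubobject m ∈ q.1 X)
    (h' : imageSubobject m' ∈ q.1 X) : ¬ IsNull (pullback m m') :=
  fun hn => TypeSpace.not_isEmptySub_of_mem (TypeSpace.inf_mem h h')
    (isEmptySub_inf_imageSubobject m m' hn)

/-- A condition compatible with `k` is shrunk into the image of `k`. For an incompatible one, its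
own image in the product over `X` is the disjoint `ψ`. -/
theorem residual_decides (hσ : ∀ i, EffectiveEpi (terminal.from (σ i))) (X : Finset I) {v : C}
    (k : v ⟶ finProd σ X) : ∀ᶠ q in residual (OmegaType σ), imageSubobject k ∈ q.1 X ∨
      ∃ ψ : Subobject (finProd σ X), ψ ∈ q.1 X ∧ IsEmptySub (ψ ⊓ imageSubobject k) := by
  refine mem_residual_of_forcing hσ X fun Y hY w m hw => ?_
  by_cases hn : IsNull (pullback (m ≫ finProj σ hY) k)
  · refine ⟨Y, subset_rfl, w, m, 𝟙 w, hw, by rw [finProj_refl]; simp, fun q hq => Or.inr ?_⟩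
    exact ⟨imageSubobject (m ≫ finProj σ hY), q.mem_of_factors hY hq (imageSubobject_factors _),
      isEmptySub_inf_imageSubobject _ _ hn⟩
  · refine ⟨Y, subset_rfl, _, pullback.fst _ _ ≫ m, pullback.fst _ _, hn,
      by rw [finProj_refl]; simp, fun q hq => Or.inl ?_⟩
    exact q.mem_of_factors hY hq (factors_of_comp_eq (pullback.snd _ _) (imageSubobject_factors k)
      (by rw [Category.assoc, pullback.condition]))

theorem exists_finProd_lift {X : Finset I} {v : C} (f : ∀ i ∈ X, v ⟶ σ i) :
    ∃ t : v ⟶ finProd σ X, ∀ i hi, t ≫ Pi.π (fun i : X => σ i) ⟨i, hi⟩ = f i hi :=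
  ⟨Pi.lift fun i => f i i.2, fun i hi => by simp⟩

theorem finProd_hom_ext {X : Finset I} {v : C} {f g : v ⟶ finProd σ X}
    (h : ∀ i hi, f ≫ Pi.π (fun i : X => σ i) ⟨i, hi⟩ = g ≫ Pi.π (fun i : X => σ i) ⟨i, hi⟩) :
    f = g :=
  Pi.hom_ext _ _ fun ⟨i, hi⟩ => h i hi

/-- A condition constrains only the finitely many coordinates in `Y`, and the sort of `i` recurs at
some `j` outside `Y`. The coordinate `j` is free to take the value of `h`. -/
theorem residual_henkin (hσ : ∀ i, EffectiveEpi (terminal.from (σ i)))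
    (hinf : ∀ i, {j | σ j = σ i}.Infinite) (Z : Finset I) {v : C} (g : v ⟶ finProd σ Z) (i : I)
    (h : v ⟶ σ i) : ∀ᶠ q in residual (OmegaType σ), imageSubobject g ∈ q.1 Z →
      ∃ (X : Finset I) (hX : Z ⊆ X) (j : I) (hj : j ∈ X) (e : σ i = σ j) (t : v ⟶ finProd σ X),
        j ∉ Z ∧ t ≫ finProj σ hX = g ∧
          t ≫ Pi.π (fun i : X => σ i) ⟨j, hj⟩ = h ≫ eqToHom e ∧ imageSubobject t ∈ q.1 X := by
  classical
  refine mem_residual_of_forcing hσ Z fun Y hY w m hw => ?_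
  by_cases hn : IsNull (pullback (m ≫ finProj σ hY) g)
  · refine ⟨Y, subset_rfl, w, m, 𝟙 w, hw, by rw [finProj_refl]; simp, fun q hq hg => ?_⟩
    exact absurd hn (q.not_isNull_pullback
      (q.mem_of_factors hY hq (imageSubobject_factors _)) hg)
  · obtain ⟨j, hji, hjY⟩ := (hinf i).exists_notMem_finset Y
    have e : σ i = σ j := hji.symm
    have hjZ : j ∉ Z := fun h => hjY (hY h)
    obtain ⟨t, ht⟩ := exists_finProd_lift (σ := σ) (X := insert j Z) (v := v) fun l hl =>
      if hl' : l ∈ Z then g ≫ Pi.π (fun i : Z => σ i) ⟨l, hl'⟩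
      else h ≫ eqToHom (e.trans (by rw [(Finset.mem_insert.1 hl).resolve_right hl']))
    -- The refined condition: the old one restricted to its overlap with `g`, with `h` as its
    -- coordinate at `j`.
    obtain ⟨m', hm'⟩ := exists_finProd_lift (σ := σ) (X := insert j Y)
      (v := pullback (m ≫ finProj σ hY) g) fun l hl =>
      if hl' : l ∈ Y then pullback.fst _ _ ≫ m ≫ Pi.π (fun i : Y => σ i) ⟨l, hl'⟩
      else pullback.snd _ _ ≫ h ≫
        eqToHom (e.trans (by rw [(Finset.mem_insert.1 hl).resolve_right hl']))
    have hY' : Y ⊆ insert j Y := Finset.subset_insert j Y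
    have hZ' : Z ⊆ insert j Z := Finset.subset_insert j Z
    have hZY : insert j Z ⊆ insert j Y := Finset.insert_subset_insert j hY
    refine ⟨insert j Y, hY', _, m', pullback.fst _ _, hn, ?_, fun q hq _ => ?_⟩
    · refine finProd_hom_ext fun l hl => ?_
      rw [Category.assoc, finProj_π, hm', dif_pos hl, Category.assoc]
    · refine ⟨insert j Z, hZ', j, Finset.mem_insert_self j Z, e, t, hjZ, ?_, ?_, ?_⟩
      · refine finProd_hom_ext fun l hl => ?_
        rw [Category.assoc, finProj_π, ht, dif_pos hl]
      · rw [ht, dif_neg hjZ]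
      · refine q.mem_of_factors hZY hq (factors_of_comp_eq (pullback.snd _ _)
          (imageSubobject_factors t) (finProd_hom_ext fun l hl => ?_))
        rw [Category.assoc, Category.assoc, finProj_π, hm', ht]
        by_cases hl' : l ∈ Z
        · rw [dif_pos hl', dif_pos (hY hl'), ← Category.assoc, ← pullback.condition]
          simp [finProj_π]
        · rw [dif_neg hl', dif_neg]
          obtain rfl := (Finset.mem_insert.1 hl).resolve_right hl'
          exact hjY

/-- A condition compatible with `k` has nonempty image in `x` under `f`. Density of `V` provides a
basic open part of `V` meeting this image, and the condition is shrunk over it. -/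
theorem residual_meets_open (hσ : ∀ i, EffectiveEpi (terminal.from (σ i))) {x : C}
    {V : Set (TypeSpace x)} (hV : IsOpen V) (hV' : Dense V) (Z : Finset I) {v : C}
    (k : v ⟶ finProd σ Z) (f : v ⟶ x) : ∀ᶠ q in residual (OmegaType σ),
      imageSubobject k ∈ q.1 Z → ∃ ψ : Subobject x, TypeSpace.basicOpen ψ ⊆ V ∧
        imageSubobject (((Subobject.pullback f).obj ψ).arrow ≫ k) ∈ q.1 Z := by
  refine mem_residual_of_forcing hσ Z fun Y hY w m hw => ?_
  by_cases hn : IsNull (pullback (m ≫ finProj σ hY) k)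
  · refine ⟨Y, subset_rfl, w, m, 𝟙 w, hw, by rw [finProj_refl]; simp, fun q hq hk => ?_⟩
    exact absurd hn (q.not_isNull_pullback
      (q.mem_of_factors hY hq (imageSubobject_factors _)) hk)
  · let g := pullback.snd (m ≫ finProj σ hY) k ≫ f
    obtain ⟨p₀, hp₀⟩ := exists_type (χ := imageSubobject g)
      (fun h => hn ((isEmptySub_imageSubobject g).1 h))
    obtain ⟨p, hpg, hpV⟩ := dense_iff_inter_open.1 hV' _
      (TypeSpace.isOpen_basicOpen (imageSubobject g)) ⟨p₀, hp₀⟩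
    obtain ⟨ψ, hψ, hψV⟩ := TypeSpace.exists_basicOpen_subset hV hpV
    have hn' : ¬ IsNull (pullback g ψ.arrow) := fun h =>
      TypeSpace.not_isEmptySub_of_mem (TypeSpace.inf_mem hpg hψ) (by
        have := isEmptySub_inf_imageSubobject g ψ.arrow h
        rwa [imageSubobject_mono ψ.arrow, Subobject.mk_arrow] at this)
    refine ⟨Y, subset_rfl, _, pullback.fst g ψ.arrow ≫ pullback.fst _ _ ≫ m,
      pullback.fst _ _ ≫ pullback.fst _ _, hn', by rw [finProj_refl]; simp, fun q hq _ => ?_⟩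
    refine ⟨ψ, hψV, q.mem_of_factors hY hq ?_⟩
    have h1 : ((Subobject.pullback f).obj ψ).Factors
        (pullback.fst g ψ.arrow ≫ pullback.snd (m ≫ finProj σ hY) k) := by
      rw [pullback_factors, Category.assoc]
      change ψ.Factors (pullback.fst g ψ.arrow ≫ g)
      rw [pullback.condition]
      exact Subobject.factors_comp_arrow _
    obtain ⟨l, hl⟩ := exists_lift h1
    refine factors_of_comp_eq l (imageSubobject_factors _) ?_
    rw [← Category.assoc, hl, Category.assoc, Category.assoc, Category.assoc,
      pullback.condition]

/-- The genericity conditions on an `ω`-type: it decides every subobject positively, it has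
witnesses for images, and every type it defines lies outside the given sets. -/
structure IsGeneric (E : ∀ X : Finset I, Set (TypeSpace (finProd σ X))) (q : OmegaType σ) :
    Prop where
  decides (X : Finset I) {v : C} (k : v ⟶ finProd σ X) : imageSubobject k ∈ q.1 X ∨
    ∃ ψ : Subobject (finProd σ X), ψ ∈ q.1 X ∧ IsEmptySub (ψ ⊓ imageSubobject k)
  henkin (Z : Finset I) {v : C} (g : v ⟶ finProd σ Z) (i : I) (h : v ⟶ σ i) :
    imageSubobject g ∈ q.1 Z →
      ∃ (X : Finset I) (hX : Z ⊆ X) (j : I) (hj : j ∈ X) (e : σ i = σ j) (t : v ⟶ finProd σ X),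
        j ∉ Z ∧ t ≫ finProj σ hX = g ∧
          t ≫ Pi.π (fun i : X => σ i) ⟨j, hj⟩ = h ≫ eqToHom e ∧ imageSubobject t ∈ q.1 X
  omits (X Z : Finset I) {v : C} (k : v ⟶ finProd σ Z) (f : v ⟶ finProd σ X) :
    imageSubobject k ∈ q.1 Z → ∀ p ∈ E X, ¬ ∀ φ, φ ∈ p ↔
      imageSubobject (((Subobject.pullback f).obj φ).arrow ≫ k) ∈ q.1 Z

/-- Countability of `C` and `I` leaves countably many requirements. For omission, a countable
intersection of dense open sets avoids `E X`, and a type meeting each requirement contains a basic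
open reason for lying in each of them. -/
theorem residual_isGeneric [CountableCategory C] [Countable I]
    (hσ : ∀ i, EffectiveEpi (terminal.from (σ i))) (hinf : ∀ i, {j | σ j = σ i}.Infinite)
    (E : ∀ X : Finset I, Set (TypeSpace (finProd σ X))) (hE : ∀ X, IsMeagre (E X)) :
    {q | IsGeneric E q} ∈ residual (OmegaType σ) := by
  have h1 : ∀ᶠ q in residual (OmegaType σ), ∀ (X : Finset I) (v : C) (k : v ⟶ finProd σ X),
      imageSubobject k ∈ q.1 X ∨
        ∃ ψ : Subobject (finProd σ X), ψ ∈ q.1 X ∧ IsEmptySub (ψ ⊓ imageSubobject k) := by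
    simp only [eventually_countable_forall]
    exact fun X v k => residual_decides hσ X k
  have h2 : ∀ᶠ q in residual (OmegaType σ), ∀ (Z : Finset I) (v : C) (g : v ⟶ finProd σ Z) (i : I)
      (h : v ⟶ σ i), imageSubobject g ∈ q.1 Z →
      ∃ (X : Finset I) (hX : Z ⊆ X) (j : I) (hj : j ∈ X) (e : σ i = σ j) (t : v ⟶ finProd σ X),
        j ∉ Z ∧ t ≫ finProj σ hX = g ∧
          t ≫ Pi.π (fun i : X => σ i) ⟨j, hj⟩ = h ≫ eqToHom e ∧ imageSubobject t ∈ q.1 X := by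
    have h (Z : Finset I) (v : C) (g : v ⟶ finProd σ Z) (i : I) (h : v ⟶ σ i) :=
      residual_henkin hσ hinf Z g i h
    simp only [← eventually_countable_forall] at h
    exact h
  have h3 : ∀ᶠ q in residual (OmegaType σ), ∀ (X Z : Finset I) (v : C) (k : v ⟶ finProd σ Z)
      (f : v ⟶ finProd σ X), imageSubobject k ∈ q.1 Z → ∀ p ∈ E X, ¬ ∀ φ, φ ∈ p ↔
        imageSubobject (((Subobject.pullback f).obj φ).arrow ≫ k) ∈ q.1 Z := by
    simp only [eventually_countable_forall]
    intro X Z v k f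
    obtain ⟨S, hSo, hSd, hSc, hS⟩ := mem_residual_iff.1 (hE X)
    have h := (eventually_countable_ball hSc).2 fun V hV =>
      residual_meets_open hσ (hSo V hV) (hSd V hV) Z k f
    filter_upwards [h] with q hq hk p hp hpq
    refine hS (Set.mem_sInter.2 fun V hV => ?_) hp
    obtain ⟨ψ, hψ, hψq⟩ := hq V hV hk
    exact hψ ((hpq ψ).2 hψq)
  filter_upwards [h1, h2, h3] with q h1 h2 h3
  exact ⟨fun X v k => h1 X v k, fun Z v g i h => h2 Z v g i h, fun X Z v k f => h3 X Z v k f⟩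

end Generic

/-! ### Atoms and points in a 2-valued category -/

section Atoms

variable {D : Type u₂} [Category.{v₂} D]

theorem IsAtomObject.not_isNull {a : D} (ha : IsAtomObject a) : ¬ IsNull a := by
  intro h
  have : Subsingleton (Subobject a) :=
    ⟨fun b c => (top_le_iff.1 (h b)).trans (top_le_iff.1 (h c)).symm⟩
  have h2 : Nat.card (Subobject a) = 2 := ha
  have := Finite.card_le_one_iff_subsingleton.2 this
  omega

variable [CoherentCategory D]

theorem IsAtomObject.eq_top {a : D} (ha : IsAtomObject a) {φ : Subobject a}
    (hφ : ¬ IsEmptySub φ) : φ = ⊤ := by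
  obtain ⟨x, y, hxy, h⟩ := Nat.card_eq_two_iff.1 ha
  obtain ⟨u, hu, -⟩ := exists_isBot a
  have hut : u ≠ ⊤ := fun e => ha.not_isNull (by rw [IsNull, ← e]; exact hu)
  have hφu : φ ≠ u := fun e => hφ (e ▸ hu)
  have h1 : u ∈ ({x, y} : Set _) := h ▸ Set.mem_univ _
  have h2 : φ ∈ ({x, y} : Set _) := h ▸ Set.mem_univ _
  have h3 : (⊤ : Subobject a) ∈ ({x, y} : Set _) := h ▸ Set.mem_univ _
  grind

theorem factors_of_cover {w x y : D} (e : w ⟶ x) [StrongEpi e] {f : x ⟶ y} {φ : Subobject y}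
    (h : φ.Factors (e ≫ f)) : φ.Factors f := by
  rw [← pullback_factors] at h
  obtain ⟨g, hg⟩ := exists_lift h
  have : IsIso ((Subobject.pullback f).obj φ).arrow := ExtremalEpi.isIso (f := e) g _ hg
  have h1 := Subobject.eq_top_of_isIso_arrow ((Subobject.pullback f).obj φ)
  have h2 : ((Subobject.pullback f).obj φ).Factors (𝟙 x) := h1 ▸ factors_top _
  simpa [pullback_factors] using h2

theorem IsTwoValued.strongEpi (hD : IsTwoValued D) {w : D} (hw : ¬ IsNull w) :
    StrongEpi (terminal.from w) := by
  have h := IsAtomObject.eq_top hD (φ := imageSubobject (terminal.from w))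
    (fun h => hw ((isEmptySub_imageSubobject _).1 h))
  have : IsIso (imageSubobject (terminal.from w)).arrow := by rw [h]; infer_instance
  rw [← imageSubobject_arrow_comp (terminal.from w)]
  exact strongEpi_comp _ _

/-- In a 2-valued coherent category, non-null subterminal objects have a global point. -/
theorem IsTwoValued.exists_point (hD : IsTwoValued D) {w : D} (hw : ¬ IsNull w)
    (hs : ∀ {T : D} (f g : T ⟶ w), f = g) : Nonempty (⊤_ D ⟶ w) := by
  have : Mono (terminal.from w) := ⟨fun f g _ => hs f g⟩
  have := hD.strongEpi hw
  have : IsIso (terminal.from w) := isIso_of_mono_of_strongEpi _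
  exact ⟨inv (terminal.from w)⟩

theorem strongEpi_prod_fst {T w : D} [StrongEpi (terminal.from w)] :
    StrongEpi (prod.fst : T ⨯ w ⟶ T) := by
  have hp := IsPullback.of_hasBinaryProduct' T w
  have : IsRegularEpi (terminal.from w) := inferInstance
  have : IsRegularEpi (prod.fst : T ⨯ w ⟶ T) :=
    Regular.regularEpiIsStableUnderBaseChange.of_isPullback hp.flip this
  infer_instance

end Atoms

/-! ### From realizing atoms to global points -/

section Points

theorem mapSub_factors {C : Type u₁} [Category.{v₁} C] {D : Type u₂} [Category.{v₂} D] (M : C ⥤ D)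
    [PreservesFiniteLimits M] {x : C} (φ : Subobject x) {T : D} (f : T ⟶ M.obj x) :
    (mapSub M φ).Factors f ↔ ∃ g : T ⟶ M.obj (φ : C), g ≫ M.map φ.arrow = f :=
  Iff.rfl

variable {C : Type u₁} [Category.{v₁} C] [CoherentCategory C] {I : Type w} {σ : I → C}
  {D : Type u₂} [Category.{v₂} D] [CoherentCategory D]

theorem prodSub_factors (M : C ⥤ D) {c : ∀ i, Subobject (M.obj (σ i))} {X : Finset I} {T : D}
    (f : T ⟶ M.obj (finProd σ X)) : (prodSub M c X).Factors f ↔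
      ∀ i hi, (c i).Factors (f ≫ M.map (Pi.π (fun i : X => σ i) ⟨i, hi⟩)) := by
  rw [prodSub, Subobject.finset_inf_factors]
  simp [pullback_factors]

variable (M : C ⥤ D) [PreservesFiniteLimits M]

theorem exists_map_finProd_lift {X : Finset I} {T : D} (f : ∀ i ∈ X, T ⟶ M.obj (σ i)) :
    ∃ t : T ⟶ M.obj (finProd σ X),
      ∀ i hi, t ≫ M.map (Pi.π (fun i : X => σ i) ⟨i, hi⟩) = f i hi := by
  refine ⟨Pi.lift (fun i : X => f i i.2) ≫ (PreservesProduct.iso M fun i : X => σ i).inv, ?_⟩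
  intro i hi
  have h : (PreservesProduct.iso M fun i : X => σ i).inv ≫ M.map (Pi.π (fun i : X => σ i) ⟨i, hi⟩) =
      Pi.π (fun i : X => M.obj (σ i)) ⟨i, hi⟩ := by
    rw [Iso.inv_comp_eq, PreservesProduct.iso_hom, piComparison_comp_π]
  rw [Category.assoc, h]
  simp

theorem map_finProd_hom_ext {X : Finset I} {T : D} {f g : T ⟶ M.obj (finProd σ X)}
    (h : ∀ i hi, f ≫ M.map (Pi.π (fun i : X => σ i) ⟨i, hi⟩) =
      g ≫ M.map (Pi.π (fun i : X => σ i) ⟨i, hi⟩)) : f = g := by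
  rw [← cancel_mono (PreservesProduct.iso M fun i : X => σ i).hom]
  refine Pi.hom_ext _ _ fun ⟨i, hi⟩ => ?_
  simpa [PreservesProduct.iso_hom] using h i hi

/-- A compatible family of global points of the `M (∏ σ i)` whose types are given by `q`. -/
structure IsPointRealization (q : OmegaType σ) (pt : ∀ X, ⊤_ D ⟶ M.obj (finProd σ X)) : Prop where
  map_finProj {X Y : Finset I} (h : Y ⊆ X) : pt X ≫ M.map (finProj σ h) = pt Y
  factors_iff (X : Finset I) (φ : Subobject (finProd σ X)) :
    (mapSub M φ).Factors (pt X) ↔ φ ∈ q.1 X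

variable {M}

/-- The atoms realizing a generic `ω`-type are subterminal. -/
theorem IsGeneric.subsingleton_hom {E : ∀ X : Finset I, Set (TypeSpace (finProd σ X))}
    {q : OmegaType σ} (hq : IsGeneric E q) (hD : IsTwoValued D) {c : ∀ i, Subobject (M.obj (σ i))}
    (hc : ∀ i, IsAtomObject (c i : D))
    (hcq : ∀ (X : Finset I) (φ : Subobject (finProd σ X)), φ ∈ q.1 X → prodSub M c X ≤ mapSub M φ)
    (i : I) {T : D} (u v : T ⟶ (c i : D)) : u = v := by
  classical
  have h1 : imageSubobject (𝟙 (finProd σ {i})) ∈ q.1 {i} := by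
    rw [eq_top_of_factors_id (imageSubobject_factors (𝟙 (finProd σ {i})))]
    exact TypeSpace.top_mem _
  -- The witness for the projection to `σ i` itself is a second index `j` at which `q` repeats
  -- coordinate `i`.
  obtain ⟨X, hX, j, hj, e, t, hji, htg, htj, ht⟩ := hq.henkin {i} (𝟙 _) i
    (Pi.π (fun l : ({i} : Finset I) => σ l) ⟨i, Finset.mem_singleton_self i⟩) h1
  replace hji : j ≠ i := fun h => hji (Finset.mem_singleton.2 h)
  have hY : {j, i} ⊆ X := Finset.insert_subset hj hX
  have hjY : j ∈ ({j, i} : Finset I) := by simp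
  have hiY : i ∈ ({j, i} : Finset I) := by simp
  let πi := Pi.π (fun l : ({j, i} : Finset I) => σ l) ⟨i, hiY⟩
  let πj := Pi.π (fun l : ({j, i} : Finset I) => σ l) ⟨j, hjY⟩
  have hti : t ≫ Pi.π (fun l : X => σ l) ⟨i, hY hiY⟩ =
      Pi.π (fun l : ({i} : Finset I) => σ l) ⟨i, Finset.mem_singleton_self i⟩ := by
    rw [← finProj_π hX i (Finset.mem_singleton_self i), ← Category.assoc, htg, Category.id_comp]
  have hφ : equalizerSubobject (πi ≫ eqToHom e) πj ∈ q.1 {j, i} := by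
    refine q.mem_of_factors hY ht (equalizerSubobject_factors _ _ _ ?_)
    simp only [πi, πj, Category.assoc]
    rw [finProj_π, ← Category.assoc (finProj σ hY), finProj_π, htj, ← hti, Category.assoc]
  -- `c i × c j` lies in `M` of the equalizer, so any generalized element of `c i` agrees with any
  -- generalized element of `c j`.
  have key {T' : D} (a : T' ⟶ (c i : D)) (b : T' ⟶ (c j : D)) :
      a ≫ (c i).arrow ≫ M.map (eqToHom e) = b ≫ (c j).arrow := by
    obtain ⟨f, hf⟩ := exists_map_finProd_lift M (σ := σ) (X := {j, i}) (T := T') fun l hl =>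
      if h : l = j then (by subst h; exact b ≫ (c l).arrow)
      else (by
        have h' : l = i := by simpa [h] using hl
        subst h'; exact a ≫ (c l).arrow)
    have hfi : f ≫ M.map πi = a ≫ (c i).arrow := by
      rw [hf, dif_neg hji.symm]
    have hfj : f ≫ M.map πj = b ≫ (c j).arrow := by
      rw [hf, dif_pos rfl]
    have h2 : (prodSub M c {j, i}).Factors f := by
      rw [prodSub_factors]
      intro l hl
      obtain rfl | h := Finset.mem_insert.1 hl
      · rw [show f ≫ M.map (Pi.π _ ⟨l, hl⟩) = _ from hfj]
        exact Subobject.factors_comp_arrow b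
      · obtain rfl := Finset.mem_singleton.1 h
        rw [show f ≫ M.map (Pi.π _ ⟨l, hl⟩) = _ from hfi]
        exact Subobject.factors_comp_arrow a
    obtain ⟨g, hg⟩ := (mapSub_factors M _ _).1 (factors_mono (hcq _ _ hφ) h2)
    rw [← Category.assoc, ← hfi, ← hfj, ← hg, Category.assoc, Category.assoc, Category.assoc,
      ← M.map_comp, ← M.map_comp, ← M.map_comp, equalizerSubobject_arrow_comp]
  -- After base change to the cover `T ⨯ c j`, both `u` and `v` equal the generic element of `c j`.
  have := hD.strongEpi (hc j).not_isNull
  have := strongEpi_prod_fst (T := T) (w := (c j : D))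
  rw [← cancel_epi (prod.fst : T ⨯ (c j : D) ⟶ T), ← cancel_mono (c i).arrow,
    ← cancel_mono (M.map (eqToHom e))]
  simp only [Category.assoc]
  rw [← Category.assoc, key _ prod.snd, ← Category.assoc, key _ prod.snd]

theorem IsGeneric.exists_isPointRealization {E : ∀ X : Finset I, Set (TypeSpace (finProd σ X))}
    {q : OmegaType σ} (hq : IsGeneric E q) (hD : IsTwoValued D) (hM : StronglyRealizesOmega M q) :
    ∃ pt, IsPointRealization M q pt := by
  obtain ⟨c, hc, hcq⟩ := hM
  have p (i) := hD.exists_point (hc i).not_isNull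
    fun f g => hq.subsingleton_hom hD hc (fun X φ => (hcq X φ).2.2) i f g
  replace p (i) := (p i).some
  choose pt hpt using fun X : Finset I =>
    exists_map_finProd_lift M (σ := σ) (X := X) fun i _ => p i ≫ (c i).arrow
  refine ⟨pt, fun {X Y} h => map_finProd_hom_ext M fun i hi => ?_, fun X φ => ?_⟩
  · rw [Category.assoc, ← M.map_comp, finProj_π, hpt, hpt]
  · have h1 : (prodSub M c X).Factors (pt X) := by
      rw [prodSub_factors]
      intro i hi
      rw [hpt]
      exact Subobject.factors_comp_arrow _
    refine ⟨fun h => (hcq X φ).1.1 fun h2 => IsAtomObject.not_isNull hD ?_,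
      fun h => factors_mono ((hcq X φ).2.2 h) h1⟩
    exact .of_factors h2 ((Subobject.inf_factors _).2 ⟨h1, h⟩)

end Points

/-! ### Named points: closure properties, decisions and lifting -/

section Named

variable {C : Type u₁} [Category.{v₁} C] [CoherentCategory C] {I : Type w} {σ : I → C}
  {D : Type u₂} [Category.{v₂} D] {M : C ⥤ D}

/-- Simultaneous witnesses for finitely many arrows into the `σ i`. -/
theorem IsGeneric.exists_witnesses {q : OmegaType σ}
    {E : ∀ X : Finset I, Set (TypeSpace (finProd σ X))} (hq : IsGeneric E q) {Z : Finset I}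
    {v : C} {g : v ⟶ finProd σ Z}
    (hg : imageSubobject g ∈ q.1 Z) {n : ℕ} (i : Fin n → I) (h : ∀ l, v ⟶ σ (i l)) :
    ∃ (X : Finset I) (hX : Z ⊆ X) (t : v ⟶ finProd σ X), t ≫ finProj σ hX = g ∧
      imageSubobject t ∈ q.1 X ∧ ∀ l, ∃ s : finProd σ X ⟶ σ (i l), t ≫ s = h l := by
  induction n with
  | zero => exact ⟨Z, subset_rfl, g, by rw [finProj_refl, Category.comp_id], hg, fun l => l.elim0⟩
  | succ n ih =>
    obtain ⟨X, hX, t, ht, htq, hs⟩ := ih (fun l => i l.castSucc) (fun l => h l.castSucc)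
    obtain ⟨Y, hY, j, hj, e, t', -, h1, h2, h3⟩ :=
      hq.henkin X t (i (Fin.last n)) (h (Fin.last n)) htq
    refine ⟨Y, hX.trans hY, t', by rw [← finProj_comp hY hX, ← Category.assoc, h1, ht], h3, ?_⟩
    intro l
    induction l using Fin.lastCases with
    | last => exact ⟨Pi.π (fun i : Y => σ i) ⟨j, hj⟩ ≫ eqToHom e.symm, by
        rw [← Category.assoc, h2, Category.assoc, eqToHom_trans, eqToHom_refl, Category.comp_id]⟩
    | cast l =>
      obtain ⟨s, hs⟩ := hs l
      exact ⟨finProj σ hY ≫ s, by rw [← Category.assoc, h1, hs]⟩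

variable (M) in
/-- A global point of `M x` is named if it is the value at a partial map `∏ σ i ⇀ x` of the given
point of `M (∏ σ i)`. -/
def IsNamed [HasTerminal D] (pt : ∀ X : Finset I, ⊤_ D ⟶ M.obj (finProd σ X)) {x : C}
    (p : ⊤_ D ⟶ M.obj x) : Prop :=
  ∃ (Z : Finset I) (v : C) (k : v ⟶ finProd σ Z) (_ : Mono k) (f : v ⟶ x) (r : ⊤_ D ⟶ M.obj v),
    r ≫ M.map k = pt Z ∧ r ≫ M.map f = p

theorem IsNamed.map [HasTerminal D] {pt : ∀ X : Finset I, ⊤_ D ⟶ M.obj (finProd σ X)}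
    {x y : C} {p : ⊤_ D ⟶ M.obj x} (hp : IsNamed M pt p) (f : x ⟶ y) :
    IsNamed M pt (p ≫ M.map f) := by
  obtain ⟨Z, v, k, hk, g, r, h1, rfl⟩ := hp
  exact ⟨Z, v, k, hk, g ≫ f, r, h1, by simp⟩

variable [PreservesFiniteLimits M]

theorem exists_map_pullback_lift {x y z : C} {f : x ⟶ z} {g : y ⟶ z} {T : D} {a : T ⟶ M.obj x}
    {b : T ⟶ M.obj y} (h : a ≫ M.map f = b ≫ M.map g) : ∃ r : T ⟶ M.obj (pullback f g),
      r ≫ M.map (pullback.fst f g) = a ∧ r ≫ M.map (pullback.snd f g) = b := by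
  have hp := (IsPullback.of_hasPullback f g).map M
  exact ⟨hp.lift a b h, hp.lift_fst _ _ _, hp.lift_snd _ _ _⟩

theorem map_prod_hom_ext {x y : C} {T : D} {a b : T ⟶ M.obj (x ⨯ y)}
    (h1 : a ≫ M.map prod.fst = b ≫ M.map prod.fst)
    (h2 : a ≫ M.map prod.snd = b ≫ M.map prod.snd) : a = b :=
  ((IsPullback.of_hasBinaryProduct' x y).map M).hom_ext h1 h2

theorem mapSub_pullback_factors {x y : C} (f : x ⟶ y) (φ : Subobject y) {T : D}
    (a : T ⟶ M.obj x) : (mapSub M ((Subobject.pullback f).obj φ)).Factors a ↔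
      (mapSub M φ).Factors (a ≫ M.map f) := by
  have hp := (Subobject.isPullback f φ).map M
  rw [mapSub_factors, mapSub_factors]
  constructor
  · rintro ⟨g, rfl⟩
    exact ⟨g ≫ M.map (Subobject.pullbackπ f φ), by simp only [Category.assoc, hp.w]⟩
  · rintro ⟨g, hg⟩
    exact ⟨hp.lift g a hg, hp.lift_snd _ _ _⟩

theorem mapSub_imageSubobject_factors {x y : C} (m : x ⟶ y) [Mono m] {T : D} (a : T ⟶ M.obj y) :
    (mapSub M (imageSubobject m)).Factors a ↔ ∃ g : T ⟶ M.obj x, g ≫ M.map m = a := by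
  rw [mapSub_factors, imageSubobject_mono]
  constructor
  · rintro ⟨g, rfl⟩
    exact ⟨g ≫ M.map (Subobject.underlyingIso m).hom, by
      rw [Category.assoc, ← M.map_comp, Subobject.underlyingIso_hom_comp_eq_mk]⟩
  · rintro ⟨g, rfl⟩
    exact ⟨g ≫ M.map (Subobject.underlyingIso m).inv, by
      rw [Category.assoc, ← M.map_comp, Subobject.underlyingIso_arrow]⟩

theorem mapSub_imageSubobject_factors_comp {x y : C} (f : x ⟶ y) {T : D} (a : T ⟶ M.obj x) :
    (mapSub M (imageSubobject f)).Factors (a ≫ M.map f) :=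
  ⟨a ≫ M.map (factorThruImageSubobject f), by
    change (_ ≫ _) ≫ M.map _ = _
    rw [Category.assoc, ← M.map_comp, imageSubobject_arrow_comp]⟩

variable [CoherentCategory D] {pt : ∀ X : Finset I, ⊤_ D ⟶ M.obj (finProd σ X)}

theorem isNamed_terminal (p : ⊤_ D ⟶ M.obj (⊤_ C)) : IsNamed M pt p :=
  ⟨∅, _, 𝟙 _, inferInstance, terminal.from _, pt ∅, by simp,
    (IsTerminal.isTerminalObj M _ terminalIsTerminal).hom_ext _ _⟩

/-- The partial map determines its value: since `k` is monic, at most one `r` lies over `pt Z`. -/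
theorem countable_isNamed [CountableCategory C] [Countable I] (x : C) :
    {p : ⊤_ D ⟶ M.obj x | IsNamed M pt p}.Countable := by
  have h : {p : ⊤_ D ⟶ M.obj x | IsNamed M pt p} =
      ⋃ (Z : Finset I) (v : C) (k : v ⟶ finProd σ Z) (f : v ⟶ x),
        {p | Mono k ∧ ∃ r : ⊤_ D ⟶ M.obj v, r ≫ M.map k = pt Z ∧ r ≫ M.map f = p} := by
    ext p
    simp only [Set.mem_iUnion, Set.mem_ofPred_eq]
    exact ⟨fun ⟨Z, v, k, hk, f, r, h⟩ => ⟨Z, v, k, f, hk, r, h⟩,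
      fun ⟨Z, v, k, f, hk, r, h⟩ => ⟨Z, v, k, hk, f, r, h⟩⟩
  rw [h]
  refine Set.countable_iUnion fun Z => Set.countable_iUnion fun v => Set.countable_iUnion fun k =>
    Set.countable_iUnion fun f => Set.Subsingleton.countable ?_
  rintro _ ⟨hk, r, hr, rfl⟩ _ ⟨-, r', hr', rfl⟩
  obtain rfl : r = r' := by rw [← cancel_mono (M.map k), hr, hr']
  rfl

variable {q : OmegaType σ} (hpt : IsPointRealization M q pt)

include hpt

theorem IsNamed.enlarge {x : C} {p : ⊤_ D ⟶ M.obj x} {Z : Finset I} {v : C} {k : v ⟶ finProd σ Z}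
    (hk : Mono k) {f : v ⟶ x} {r : ⊤_ D ⟶ M.obj v} (hr : r ≫ M.map k = pt Z)
    (hp : r ≫ M.map f = p) {Z' : Finset I} (h : Z ⊆ Z') :
    ∃ (v : C) (k : v ⟶ finProd σ Z') (_ : Mono k) (f : v ⟶ x) (r : ⊤_ D ⟶ M.obj v),
      r ≫ M.map k = pt Z' ∧ r ≫ M.map f = p := by
  obtain ⟨s, h1, h2⟩ := exists_map_pullback_lift (M := M) (f := finProj σ h) (g := k)
    ((hpt.map_finProj h).trans hr.symm)
  exact ⟨_, pullback.fst _ _, inferInstance, pullback.snd _ _ ≫ f, s, h1, by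
    rw [M.map_comp, ← Category.assoc, h2, hp]⟩

/-- Both partial maps are moved to a common finite product and restricted to the intersection of
their domains. Pulling back `(a, b)` along the paired map gives a smaller domain, still monic
because `(a, b)` is. -/
theorem IsNamed.of_jointly_mono {x y z : C} {a : z ⟶ x} {b : z ⟶ y} [Mono (prod.lift a b)]
    {p : ⊤_ D ⟶ M.obj z} (ha : IsNamed M pt (p ≫ M.map a)) (hb : IsNamed M pt (p ≫ M.map b)) :
    IsNamed M pt p := by
  classical
  obtain ⟨Z₁, v₁, k₁, hk₁, f₁, r₁, h1, h1'⟩ := ha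
  obtain ⟨Z₂, v₂, k₂, hk₂, f₂, r₂, h2, h2'⟩ := hb
  obtain ⟨v₁, k₁, hk₁, f₁, r₁, h1, h1'⟩ := IsNamed.enlarge hpt hk₁ h1 h1'
    (Finset.subset_union_left (s₁ := Z₁) (s₂ := Z₂))
  obtain ⟨v₂, k₂, hk₂, f₂, r₂, h2, h2'⟩ := IsNamed.enlarge hpt hk₂ h2 h2'
    (Finset.subset_union_right (s₁ := Z₁) (s₂ := Z₂))
  obtain ⟨s, hs1, hs2⟩ := exists_map_pullback_lift (M := M) (h1.trans h2.symm)
  let g := prod.lift (pullback.fst k₁ k₂ ≫ f₁) (pullback.snd k₁ k₂ ≫ f₂)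
  obtain ⟨r, hr1, hr2⟩ := exists_map_pullback_lift (M := M) (f := g) (g := prod.lift a b) (a := s)
    (b := p) (map_prod_hom_ext
      (by simp only [Category.assoc, ← M.map_comp, g, prod.lift_fst]
          rw [M.map_comp, ← Category.assoc, hs1, h1'])
      (by simp only [Category.assoc, ← M.map_comp, g, prod.lift_snd]
          rw [M.map_comp, ← Category.assoc, hs2, h2']))
  refine ⟨_, _, pullback.fst g _ ≫ pullback.fst k₁ k₂ ≫ k₁, inferInstance, pullback.snd _ _, r,
    ?_, hr2⟩
  rw [M.map_comp, ← Category.assoc, hr1, M.map_comp, ← Category.assoc, hs1, h1]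

theorem IsPointRealization.imageSubobject_mem {Z : Finset I} {v : C} {k : v ⟶ finProd σ Z}
    {r : ⊤_ D ⟶ M.obj v} (hr : r ≫ M.map k = pt Z) : imageSubobject k ∈ q.1 Z := by
  rw [← hpt.factors_iff, ← hr]
  exact mapSub_imageSubobject_factors_comp k r

/-- The type of a named point, in terms of the `ω`-type. -/
theorem IsPointRealization.mapSub_factors_iff {Z : Finset I} {v x : C} {k : v ⟶ finProd σ Z}
    [Mono k] {f : v ⟶ x} {r : ⊤_ D ⟶ M.obj v} (hr : r ≫ M.map k = pt Z) (φ : Subobject x) :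
    (mapSub M φ).Factors (r ≫ M.map f) ↔
      imageSubobject (((Subobject.pullback f).obj φ).arrow ≫ k) ∈ q.1 Z := by
  rw [← mapSub_pullback_factors, ← hpt.factors_iff, mapSub_imageSubobject_factors, mapSub_factors]
  constructor
  · rintro ⟨g, rfl⟩
    exact ⟨g, by rw [M.map_comp, ← Category.assoc, hr]⟩
  · rintro ⟨g, hg⟩
    exact ⟨g, by rw [← cancel_mono (M.map k), hr, ← hg, M.map_comp, Category.assoc]⟩

variable {E : ∀ X : Finset I, Set (TypeSpace (finProd σ X))} (hq : IsGeneric E q)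

include hq

theorem IsNamed.decides {x : C} {p : ⊤_ D ⟶ M.obj x} (hp : IsNamed M pt p) (φ : Subobject x) :
    (mapSub M φ).Factors p ∨ ∃ ψ : Subobject x, IsEmptySub (ψ ⊓ φ) ∧ (mapSub M ψ).Factors p := by
  obtain ⟨Z, v, k, hk, f, r, hr, rfl⟩ := hp
  rw [hpt.mapSub_factors_iff hr]
  refine (hq.decides Z (((Subobject.pullback f).obj φ).arrow ≫ k)).imp_right ?_
  rintro ⟨θ, hθ, hθφ⟩
  -- With `θ` disjoint from `k(f^* φ)`, the image `f(k^* θ)` is disjoint from `φ` and contains the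
  -- named point.
  refine ⟨imageSubobject (((Subobject.pullback k).obj θ).arrow ≫ f), ?_, ?_⟩
  · have h := isEmptySub_inf_imageSubobject (((Subobject.pullback k).obj θ).arrow ≫ f) φ.arrow
    rw [imageSubobject_mono φ.arrow, Subobject.mk_arrow] at h
    refine h (.of_factors hθφ (f := pullback.fst _ _ ≫ ((Subobject.pullback k).obj θ).arrow ≫ k)
      ((Subobject.inf_factors _).2 ⟨?_, ?_⟩))
    · rw [← Category.assoc, ← pullback_factors]
      exact Subobject.factors_comp_arrow _
    · have h2 : ((Subobject.pullback f).obj φ).Factors (pullback.fst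
          (((Subobject.pullback k).obj θ).arrow ≫ f) φ.arrow ≫
            ((Subobject.pullback k).obj θ).arrow) := by
        rw [pullback_factors, Category.assoc, pullback.condition]
        exact Subobject.factors_comp_arrow _
      obtain ⟨l, hl⟩ := exists_lift h2
      exact factors_of_comp_eq l (imageSubobject_factors _) (by
        rw [← Category.assoc, hl, Category.assoc])
  · rw [← hpt.factors_iff, ← hr, ← mapSub_pullback_factors, mapSub_factors] at hθ
    obtain ⟨g, rfl⟩ := hθ
    rw [Category.assoc, ← M.map_comp]
    exact mapSub_imageSubobject_factors_comp _ g

/-- The pullback of `e` covers the domain of the partial map, so its image still belongs to `q`.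
Witnesses for the coordinates of the filtration embedding of `y` turn it into the domain of a
partial map into `y`. -/
theorem IsNamed.exists_lift (F : Filtration C) (hF : ∀ s ∈ F.sorts, ∃ i, σ i = s) {x y : C}
    (e : y ⟶ x) [StrongEpi e] {p : ⊤_ D ⟶ M.obj x} (hp : IsNamed M pt p) :
    ∃ p' : ⊤_ D ⟶ M.obj y, IsNamed M pt p' ∧ p' ≫ M.map e = p := by
  obtain ⟨Z, v, k, hk, f, r, hr, rfl⟩ := hp
  have : StrongEpi (pullback.fst f e) := inferInstance
  have h1 : imageSubobject (pullback.fst f e ≫ k) ∈ q.1 Z := by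
    refine TypeSpace.mem_mono ?_ (hpt.imageSubobject_mem hr)
    rw [imageSubobject_le_iff]
    exact factors_of_cover (pullback.fst f e) (imageSubobject_factors _)
  choose i hi using fun l => hF _ (F.sort_mem y l)
  obtain ⟨X, hX, t, ht, htq, hs⟩ := hq.exists_witnesses h1 i
    fun l => pullback.snd f e ≫ F.ι y l ≫ eqToHom (hi l).symm
  -- The old coordinates separate the component in `v` because `k` is monic, the new ones the
  -- component in `y` because `F.ι y` is jointly monic.
  have htm : Mono t := by
    refine ⟨fun {T} a b hab => pullback.hom_ext ?_ ?_⟩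
    · rw [← cancel_mono k, Category.assoc, Category.assoc, ← ht, ← Category.assoc, hab,
        Category.assoc]
    · have := F.mono_ι y
      rw [← cancel_mono (Pi.lift (F.ι y))]
      refine Pi.hom_ext _ _ fun l => ?_
      obtain ⟨s, hs⟩ := hs l
      rw [← cancel_mono (eqToHom (hi l).symm)]
      simp only [Category.assoc, limit.lift_π, Fan.mk_pt, Fan.mk_π_app]
      rw [← hs, ← Category.assoc, hab, Category.assoc]
  rw [← hpt.factors_iff, mapSub_imageSubobject_factors] at htq
  obtain ⟨r', hr'⟩ := htq
  refine ⟨r' ≫ M.map (pullback.snd f e), ⟨X, _, t, htm, _, r', hr', rfl⟩, ?_⟩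
  rw [Category.assoc, ← M.map_comp, ← pullback.condition, M.map_comp, ← Category.assoc]
  congr 1
  rw [← cancel_mono (M.map k), Category.assoc, ← M.map_comp, ← ht, M.map_comp, ← Category.assoc,
    hr', hpt.map_finProj, hr]

end Named

/-! ### Countable unions of global points -/

section PointUnion

variable {D : Type u₂} [Category.{v₂} D] [AlephOneGeometricCategory D]

theorem exists_pointUnion {y : D} {S : Set (⊤_ D ⟶ y)} (hS : S.Countable) :
    ∃ u : Subobject y, IsLUB ((fun p => Subobject.mk p) '' S) u ∧ ∀ {z : D} (f : z ⟶ y),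
      IsLUB ((Subobject.pullback f).obj '' ((fun p => Subobject.mk p) '' S))
        ((Subobject.pullback f).obj u) :=
  AlephOneGeometricCategory.exists_union _ (hS.image _)

/-- The union of a countable set of global points of an object. -/
noncomputable def pointUnion {y : D} {S : Set (⊤_ D ⟶ y)} (hS : S.Countable) : Subobject y :=
  (exists_pointUnion hS).choose

variable {y : D} {S : Set (⊤_ D ⟶ y)} (hS : S.Countable)

theorem mk_point_le_iff (p : ⊤_ D ⟶ y) (t : Subobject y) : Subobject.mk p ≤ t ↔ t.Factors p := by
  rw [← imageSubobject_mono, imageSubobject_le_iff]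

theorem pointUnion_le_iff (t : Subobject y) : pointUnion hS ≤ t ↔ ∀ p ∈ S, t.Factors p := by
  have h : IsLUB ((fun p => Subobject.mk p) '' S) (pointUnion hS) :=
    (exists_pointUnion hS).choose_spec.1
  simp [isLUB_le_iff h, mem_upperBounds, mk_point_le_iff]

theorem pointUnion_factors {p : ⊤_ D ⟶ y} (hp : p ∈ S) : (pointUnion hS).Factors p :=
  (pointUnion_le_iff hS _).1 le_rfl p hp

theorem isLUB_pullback_pointUnion {z : D} (f : z ⟶ y) :
    IsLUB ((Subobject.pullback f).obj '' ((fun p => Subobject.mk p) '' S))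
      ((Subobject.pullback f).obj (pointUnion hS)) :=
  (exists_pointUnion hS).choose_spec.2 f

theorem inf_pullback_pointUnion_le {z : D} (f : z ⟶ y) {a t : Subobject z}
    (h : ∀ p ∈ S, a ⊓ (Subobject.pullback f).obj (Subobject.mk p) ≤ t) :
    a ⊓ (Subobject.pullback f).obj (pointUnion hS) ≤ t := by
  refine inf_le_of_isLUB (S := (Subobject.pullback f).obj '' ((fun p => Subobject.mk p) '' S))
    ?_ ?_
  · rw [Set.image_image]
    simp only [← Subobject.pullback_comp]
    exact isLUB_pullback_pointUnion hS (a.arrow ≫ f)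
  · rintro _ ⟨_, ⟨p, hp, rfl⟩, rfl⟩
    exact h p hp

theorem comp_eq_of_mk_factors {z T : D} {f : z ⟶ y} {p : ⊤_ D ⟶ y} {a : T ⟶ z}
    (h : ((Subobject.pullback f).obj (Subobject.mk p)).Factors a) :
    a ≫ f = terminal.from T ≫ p := by
  rw [pullback_factors, factors_mk] at h
  obtain ⟨g, hg⟩ := h
  rw [← hg, Subsingleton.elim g (terminal.from T)]

/-- The intersection of inverse images of unions of points along a jointly monic pair is a union
of points. -/
theorem inf_pullback_pointUnion_le_of_jointly_mono (hD : IsTwoValued D) {z x : D}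
    {S' : Set (⊤_ D ⟶ x)} (hS' : S'.Countable) (f : z ⟶ y) (g : z ⟶ x)
    (hfg : ∀ {T : D} (a b : T ⟶ z), a ≫ f = b ≫ f → a ≫ g = b ≫ g → a = b) {t : Subobject z}
    (ht : ∀ p : ⊤_ D ⟶ z, p ≫ f ∈ S → p ≫ g ∈ S' → t.Factors p) :
    (Subobject.pullback f).obj (pointUnion hS) ⊓ (Subobject.pullback g).obj (pointUnion hS') ≤
      t := by
  -- Distributing over both unions leaves the fibre over one pair `(s, s')`. Joint monicity makes it
  -- subterminal, so it is null or is itself a global point.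
  refine inf_pullback_pointUnion_le hS' g fun s' hs' => ?_
  rw [inf_comm]
  refine inf_pullback_pointUnion_le hS f fun s hs => ?_
  rw [inf_comm]
  set b := (Subobject.pullback f).obj (Subobject.mk s) ⊓
    (Subobject.pullback g).obj (Subobject.mk s') with hb
  have h1 {T : D} (a : T ⟶ z) (ha : b.Factors a) :
      a ≫ f = terminal.from T ≫ s ∧ a ≫ g = terminal.from T ≫ s' := by
    rw [hb, Subobject.inf_factors] at ha
    exact ⟨comp_eq_of_mk_factors ha.1, comp_eq_of_mk_factors ha.2⟩
  have h2 {T : D} (a a' : T ⟶ (b : D)) : a = a' := by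
    obtain ⟨e1, e2⟩ := h1 _ (Subobject.factors_comp_arrow a)
    obtain ⟨e3, e4⟩ := h1 _ (Subobject.factors_comp_arrow a')
    rw [← cancel_mono b.arrow]
    exact hfg _ _ (e1.trans e3.symm) (e2.trans e4.symm)
  by_cases hn : IsNull (b : D)
  · exact isEmptySub_iff.2 hn t
  · obtain ⟨p⟩ := hD.exists_point hn h2
    obtain ⟨e1, e2⟩ := h1 _ (Subobject.factors_comp_arrow p)
    rw [Subsingleton.elim (terminal.from (⊤_ D)) (𝟙 _), Category.id_comp] at e1 e2
    have h3 := ht (p ≫ b.arrow) (e1 ▸ hs) (e2 ▸ hs')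
    rw [le_iff_factors]
    refine factors_of_comp_eq (terminal.from _) h3 ?_
    rw [← Category.assoc, h2 (terminal.from _ ≫ p) (𝟙 _), Category.id_comp]

theorem factors_pointUnion_of_jointly_mono (hD : IsTwoValued D) {z x : D}
    {S' : Set (⊤_ D ⟶ x)} (hS' : S'.Countable) (f : z ⟶ y) (g : z ⟶ x)
    (hfg : ∀ {T : D} (a b : T ⟶ z), a ≫ f = b ≫ f → a ≫ g = b ≫ g → a = b) {t : Subobject z}
    (ht : ∀ p : ⊤_ D ⟶ z, p ≫ f ∈ S → p ≫ g ∈ S' → t.Factors p) {T : D} {a : T ⟶ z}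
    (h1 : (pointUnion hS).Factors (a ≫ f)) (h2 : (pointUnion hS').Factors (a ≫ g)) :
    t.Factors a :=
  factors_mono (inf_pullback_pointUnion_le_of_jointly_mono hS hD hS' f g hfg ht)
    ((Subobject.inf_factors _).2 ⟨(pullback_factors _ _ _).2 h1, (pullback_factors _ _ _).2 h2⟩)

theorem eq_top_of_factors_points {t : Subobject (pointUnion hS : D)}
    (h : ∀ p : ⊤_ D ⟶ (pointUnion hS : D), p ≫ (pointUnion hS).arrow ∈ S → t.Factors p) :
    t = ⊤ := by
  have h1 : pointUnion hS ≤ Subobject.mk (t.arrow ≫ (pointUnion hS).arrow) := by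
    rw [pointUnion_le_iff]
    intro p hp
    obtain ⟨p', hp'⟩ := exists_lift (pointUnion_factors hS hp)
    obtain ⟨g, hg⟩ := exists_lift (h p' (hp'.symm ▸ hp))
    exact (factors_mk _).2 ⟨g, by rw [← Category.assoc, hg, hp']⟩
  obtain ⟨g, hg⟩ := (factors_mk _).1 (le_iff_factors.1 h1)
  refine eq_top_of_factors_id (factors_of_comp_eq g (Subobject.factors_self t) ?_)
  rw [← cancel_mono (pointUnion hS).arrow, Category.assoc, hg, Category.id_comp]

/-- An atom contained in a union of points is one of these points. -/
theorem exists_point_of_isAtomObject (hD : IsTwoValued D) {a : D} (ha : IsAtomObject a)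
    (f : a ⟶ y) [Mono f] (hf : (pointUnion hS).Factors f) :
    ∃ s : ⊤_ D ⟶ a, s ≫ f ∈ S := by
  -- If every point had empty inverse image, stability would make the atom null. A nonempty inverse
  -- image is the whole atom, so `f` is constant there.
  have h1 : ∃ p ∈ S, ¬ IsEmptySub ((Subobject.pullback f).obj (Subobject.mk p)) := by
    by_contra! h
    have h2 : (⊤ : Subobject a) ≤ (Subobject.pullback f).obj (pointUnion hS) := by
      rw [le_iff_factors, pullback_factors]
      exact Subobject.factors_of_factors_right _ hf
    refine ha.not_isNull fun t => h2.trans ((isLUB_pullback_pointUnion hS f).2 ?_)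
    rintro _ ⟨_, ⟨p, hp, rfl⟩, rfl⟩
    exact h p hp t
  obtain ⟨p, hp, hn⟩ := h1
  have h2 {T : D} (b : T ⟶ a) : b ≫ f = terminal.from T ≫ p := by
    refine comp_eq_of_mk_factors ?_
    rw [ha.eq_top hn]
    exact factors_top b
  obtain ⟨s⟩ := hD.exists_point ha.not_isNull fun b c => by
    rw [← cancel_mono f, h2, h2]
  refine ⟨s, ?_⟩
  rw [h2, Subsingleton.elim (terminal.from (⊤_ D)) (𝟙 _), Category.id_comp]
  exact hp

end PointUnion

/-! ### Subfunctors and preservation of pullbacks -/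

section Subfunctor

variable {C : Type u₁} [Category.{v₁} C] {D : Type u₂} [Category.{v₂} D] {M : C ⥤ D}

/-- The subfunctor given by a family of subobjects preserved by the arrows. -/
noncomputable def subfunctor (u : ∀ x, Subobject (M.obj x))
    (h : ∀ {x y : C} (f : x ⟶ y), (u y).Factors ((u x).arrow ≫ M.map f)) : C ⥤ D where
  obj x := (u x : D)
  map f := (u _).factorThru _ (h f)
  map_id x := by simp
  map_comp f g := by simp [← cancel_mono (u _).arrow]

theorem subfunctor_map_arrow (u : ∀ x, Subobject (M.obj x))
    (h : ∀ {x y : C} (f : x ⟶ y), (u y).Factors ((u x).arrow ≫ M.map f)) {x y : C} (f : x ⟶ y) :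
    (subfunctor u h).map f ≫ (u y).arrow = (u x).arrow ≫ M.map f :=
  Subobject.factorThru_arrow _ _ (h f)

/-- The inclusion of a subfunctor. -/
noncomputable def subfunctorι (u : ∀ x, Subobject (M.obj x))
    (h : ∀ {x y : C} (f : x ⟶ y), (u y).Factors ((u x).arrow ≫ M.map f)) :
    subfunctor u h ⟶ M where
  app x := (u x).arrow
  naturality _ _ f := subfunctor_map_arrow u h f

/-- A cone over the `N`-diagram factors through the pullback in `M`. The hypothesis places this
factorization in `N`, and uniqueness is tested in `M`. -/
theorem preservesPullbacks_of_mono {N : C ⥤ D} (α : N ⟶ M) [∀ x, Mono (α.app x)] [HasPullbacks C]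
    [PreservesLimitsOfShape WalkingCospan M]
    (hα : ∀ {x y z : C} (f : x ⟶ z) (g : y ⟶ z) {T : D} (a : T ⟶ M.obj (pullback f g)),
      (∃ b, b ≫ α.app x = a ≫ M.map (pullback.fst f g)) →
      (∃ b, b ≫ α.app y = a ≫ M.map (pullback.snd f g)) → ∃ b, b ≫ α.app _ = a) :
    PreservesLimitsOfShape WalkingCospan N where
  preservesLimit {K} := by
    have (f : K.obj .left ⟶ K.obj .one) (g : K.obj .right ⟶ K.obj .one) :
        PreservesLimit (cospan f g) N := by
      have hp := (IsPullback.of_hasPullback f g).map M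
      have hs (s : PullbackCone (N.map f) (N.map g)) :
          ∃ l : s.pt ⟶ N.obj (pullback f g), l ≫ N.map (pullback.fst f g) = s.fst ∧
            l ≫ N.map (pullback.snd f g) = s.snd := by
        have hw : (s.fst ≫ α.app _) ≫ M.map f = (s.snd ≫ α.app _) ≫ M.map g := by
          rw [Category.assoc, Category.assoc, ← α.naturality, ← α.naturality, ← Category.assoc,
            s.condition, Category.assoc]
        obtain ⟨l, hl⟩ := hα f g (hp.lift _ _ hw) ⟨s.fst, (hp.lift_fst _ _ hw).symm⟩
          ⟨s.snd, (hp.lift_snd _ _ hw).symm⟩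
        refine ⟨l, ?_, ?_⟩
        · rw [← cancel_mono (α.app _), Category.assoc, α.naturality, ← Category.assoc, hl,
            hp.lift_fst]
        · rw [← cancel_mono (α.app _), Category.assoc, α.naturality, ← Category.assoc, hl,
            hp.lift_snd]
      choose l h1 h2 using hs
      refine preservesLimit_of_preserves_limit_cone (pullbackIsPullback f g)
        ((isLimitMapConePullbackConeEquiv _ pullback.condition).symm
          (PullbackCone.IsLimit.mk _ l h1 h2 fun s m e1 e2 => ?_))
      rw [← cancel_mono (α.app _)]
      refine hp.hom_ext ?_ ?_
      · rw [Category.assoc, Category.assoc, ← α.naturality, ← Category.assoc, ← Category.assoc,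
          e1, h1]
      · rw [Category.assoc, Category.assoc, ← α.naturality, ← Category.assoc, ← Category.assoc,
          e2, h2]
    exact preservesLimit_of_iso_diagram _ (diagramIsoCospan K).symm

end Subfunctor

/-! ### The model of named points -/

section PointModel

variable {C : Type u₁} [Category.{v₁} C] [CoherentCategory C] {I : Type w} {σ : I → C}
  {D : Type u₂} [Category.{v₂} D] [AlephOneGeometricCategory D] {M : C ⥤ D}

/-- A subfunctor of `M` whose values are the unions of the named points. -/
structure IsPointModel (pt : ∀ X : Finset I, ⊤_ D ⟶ M.obj (finProd σ X)) {N : C ⥤ D} (α : N ⟶ M) :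
    Prop where
  mono (x : C) : Mono (α.app x)
  countable (x : C) : {p : ⊤_ D ⟶ M.obj x | IsNamed M pt p}.Countable
  exists_iff {x : C} {T : D} (a : T ⟶ M.obj x) :
    (∃ b, b ≫ α.app x = a) ↔ (pointUnion (countable x)).Factors a
  eq_top {x : C} {t : Subobject (N.obj x)}
    (h : ∀ p, IsNamed M pt (p ≫ α.app x) → t.Factors p) : t = ⊤

variable {pt : ∀ X : Finset I, ⊤_ D ⟶ M.obj (finProd σ X)} {N : C ⥤ D} {α : N ⟶ M}

theorem IsPointModel.exists_of_isNamed (hα : IsPointModel pt α) {x : C} {p : ⊤_ D ⟶ M.obj x}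
    (hp : IsNamed M pt p) : ∃ b, b ≫ α.app x = p :=
  (hα.exists_iff p).2 (pointUnion_factors _ hp)

variable [PreservesFiniteLimits M] {q : OmegaType σ}

theorem exists_isPointModel [CountableCategory C] [Countable I]
    (pt : ∀ X : Finset I, ⊤_ D ⟶ M.obj (finProd σ X)) :
    ∃ (N : C ⥤ D) (α : N ⟶ M), IsPointModel pt α := by
  let u (x : C) : Subobject (M.obj x) := pointUnion (countable_isNamed (pt := pt) x)
  have h {x y : C} (f : x ⟶ y) : (u y).Factors ((u x).arrow ≫ M.map f) := by
    rw [← pullback_factors, ← le_iff_factors]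
    refine (pointUnion_le_iff _ _).2 fun p hp => ?_
    rw [pullback_factors]
    exact pointUnion_factors _ (hp.map f)
  refine ⟨subfunctor u h, subfunctorι u h, fun x => Subobject.arrow_mono (u x),
    countable_isNamed, fun {x T} a => ⟨?_, exists_lift⟩,
    fun {x t} ht => eq_top_of_factors_points (countable_isNamed (pt := pt) x) ht⟩
  rintro ⟨b, rfl⟩
  exact Subobject.factors_comp_arrow (P := u x) b

/-- This transfers the closure of named points under jointly monic coordinates to generalized
elements, giving both preservation of pullbacks and the description of `N φ`. -/
theorem IsPointModel.exists_of_jointly_mono (hα : IsPointModel pt α) (hD : IsTwoValued D)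
    (hpt : IsPointRealization M q pt) {x y z : C} (f : z ⟶ x) (g : z ⟶ y) [Mono (prod.lift f g)]
    {T : D} {a : T ⟶ M.obj z} (h1 : ∃ b, b ≫ α.app x = a ≫ M.map f)
    (h2 : ∃ b, b ≫ α.app y = a ≫ M.map g) : ∃ b, b ≫ α.app z = a := by
  rw [hα.exists_iff] at h1 h2 ⊢
  refine factors_pointUnion_of_jointly_mono _ hD _ (M.map f) (M.map g) ?_ ?_ h1 h2
  · intro T a b h1 h2
    rw [← cancel_mono (M.map (prod.lift f g))]
    refine map_prod_hom_ext ?_ ?_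
    · simpa only [Category.assoc, ← M.map_comp, prod.lift_fst] using h1
    · simpa only [Category.assoc, ← M.map_comp, prod.lift_snd] using h2
  · exact fun p h1 h2 => pointUnion_factors _ (IsNamed.of_jointly_mono hpt h1 h2)

theorem mono_prod_lift_self {x y : C} (f : x ⟶ y) [Mono f] : Mono (prod.lift f f) := by
  have : Mono (prod.lift f f ≫ prod.fst) := by rwa [prod.lift_fst]
  exact mono_of_mono _ prod.fst

theorem mono_prod_lift_pullback {x y z : C} (f : x ⟶ z) (g : y ⟶ z) :
    Mono (prod.lift (pullback.fst f g) (pullback.snd f g)) :=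
  ⟨fun a b h => pullback.hom_ext
    (by simpa only [Category.assoc, prod.lift_fst] using h =≫ prod.fst)
    (by simpa only [Category.assoc, prod.lift_snd] using h =≫ prod.snd)⟩

theorem IsPointModel.preservesFiniteLimits (hα : IsPointModel pt α) (hD : IsTwoValued D)
    (hpt : IsPointRealization M q pt) : PreservesFiniteLimits N := by
  have := hα.mono
  have h1 : PreservesLimitsOfShape WalkingCospan N := preservesPullbacks_of_mono α
    fun f g _ a => by
      have := mono_prod_lift_pullback f g
      exact hα.exists_of_jointly_mono hD hpt (pullback.fst f g) (pullback.snd f g)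
  have hM := IsTerminal.isTerminalObj M _ (terminalIsTerminal (C := C))
  have h2 : IsIso (α.app (⊤_ C)) := by
    obtain ⟨b, hb⟩ := hα.exists_of_isNamed (isNamed_terminal (pt := pt) (hM.from (⊤_ D)))
    refine ⟨terminal.from _ ≫ b, ?_, hM.hom_ext _ _⟩
    rw [← cancel_mono (α.app (⊤_ C))]
    exact hM.hom_ext _ _
  have h3 : PreservesLimit (Functor.empty.{0} C) N :=
    preservesTerminal_of_iso N (asIso (α.app (⊤_ C)) ≪≫ hM.uniqueUpToIso terminalIsTerminal)
  have := preservesLimitsOfShape_pempty_of_preservesTerminal N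
  exact preservesFiniteLimits_of_preservesTerminal_and_pullbacks N

theorem IsPointModel.mapSub_factors (hα : IsPointModel pt α) (hD : IsTwoValued D)
    (hpt : IsPointRealization M q pt) [PreservesFiniteLimits N] {x : C} (φ : Subobject x) {T : D}
    (a : T ⟶ N.obj x) : (mapSub N φ).Factors a ↔ (mapSub M φ).Factors (a ≫ α.app x) := by
  have := hα.mono
  rw [PosModel.mapSub_factors, PosModel.mapSub_factors]
  constructor
  · rintro ⟨g, rfl⟩
    exact ⟨g ≫ α.app _, by rw [Category.assoc, Category.assoc, α.naturality]⟩
  · rintro ⟨g, hg⟩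
    -- A monomorphism paired with itself is jointly monic.
    have := mono_prod_lift_self φ.arrow
    obtain ⟨b, rfl⟩ := hα.exists_of_jointly_mono hD hpt φ.arrow φ.arrow (a := g) ⟨a, hg.symm⟩
      ⟨a, hg.symm⟩
    refine ⟨b, ?_⟩
    rw [← cancel_mono (α.app x), Category.assoc, α.naturality, ← hg, Category.assoc]

theorem IsPointModel.mapSub_eq (hα : IsPointModel pt α) (hD : IsTwoValued D)
    (hpt : IsPointRealization M q pt) [PreservesFiniteLimits N] {x : C} (φ : Subobject x) :
    mapSub N φ = (Subobject.pullback (α.app x)).obj (mapSub M φ) := by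
  refine le_antisymm (le_iff_factors.2 ?_) (le_iff_factors.2 ?_)
  · rw [pullback_factors, ← hα.mapSub_factors hD hpt]
    exact Subobject.factors_self _
  · rw [hα.mapSub_factors hD hpt, ← pullback_factors]
    exact Subobject.factors_self _

theorem isLUB_pullback_image {x y : D} (f : y ⟶ x) {S : Set (Subobject x)} (hS : S.Finite)
    {u : Subobject x} (hu : IsLUB S u) :
    IsLUB ((Subobject.pullback f).obj '' S) ((Subobject.pullback f).obj u) := by
  obtain ⟨u', h1, h2⟩ := CoherentCategory.exists_union S hS
  obtain rfl := h1.unique hu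
  exact h2 f

variable {E : ∀ X : Finset I, Set (TypeSpace (finProd σ X))}

/-- The image of `N e` contains every named point, since named points lift along covers; it is
therefore everything. Unions are those of `M` pulled back along `α`. -/
theorem IsPointModel.coherentFunctor (hM : ∀ {x : C} (S : Set (Subobject x)) (u : Subobject x),
    S.Finite → IsLUB S u → IsLUB (mapSub M '' S) (mapSub M u)) (hα : IsPointModel pt α)
    (hD : IsTwoValued D) (hpt : IsPointRealization M q pt) (hq : IsGeneric E q) (F : Filtration C)
    (hF : ∀ s ∈ F.sorts, ∃ i, σ i = s) : CoherentFunctor N := by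
  have := hα.mono
  have hN := hα.preservesFiniteLimits hD hpt
  refine { toPreservesFiniteLimits := hN, preserves := ?_, map_union := ?_ }
  · intro y x e he
    have : StrongEpi e := inferInstance
    have h : imageSubobject (N.map e) = ⊤ := by
      refine hα.eq_top fun p hp => ?_
      obtain ⟨p', hp', h⟩ := hp.exists_lift hpt hq F hF e
      obtain ⟨b, rfl⟩ := hα.exists_of_isNamed hp'
      refine factors_of_comp_eq b (imageSubobject_factors (N.map e)) ?_
      rw [← cancel_mono (α.app x), Category.assoc, α.naturality, ← h, Category.assoc]
    have : IsIso (imageSubobject (N.map e)).arrow := by rw [h]; infer_instance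
    have : StrongEpi (N.map e) := by
      rw [← imageSubobject_arrow_comp (N.map e)]
      exact strongEpi_comp _ _
    infer_instance
  · intro x S u hS hu
    have h := isLUB_pullback_image (α.app x) (hS.image _) (hM S u hS hu)
    rw [Set.image_image] at h
    simpa only [← hα.mapSub_eq hD hpt] using h

theorem IsPointModel.positivelyClosed (hα : IsPointModel pt α) (hD : IsTwoValued D)
    (hpt : IsPointRealization M q pt) (hq : IsGeneric E q) [PreservesFiniteLimits N] :
    PositivelyClosed N := by
  intro x φ
  refine ⟨fun _ _ => le_top, fun t ht => ?_⟩
  rw [hα.eq_top (t := t) fun p hp => ?_]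
  obtain h | ⟨ψ, h1, h2⟩ := hp.decides hpt hq φ
  · exact factors_mono (ht (Or.inl rfl)) ((hα.mapSub_factors hD hpt φ p).2 h)
  · exact factors_mono (ht (Or.inr ⟨ψ, h1, rfl⟩)) ((hα.mapSub_factors hD hpt ψ p).2 h2)

/-- A realizing atom contains a named point, and 2-valuedness makes `p` the type of that point.
Genericity excludes such types from `E X`. -/
theorem IsPointModel.weaklyOmits (hα : IsPointModel pt α) (hD : IsTwoValued D)
    (hpt : IsPointRealization M q pt) (hq : IsGeneric E q) [PreservesFiniteLimits N]
    (X : Finset I) {p : TypeSpace (finProd σ X)} (hp : p ∈ E X) : WeaklyOmits N p := by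
  rintro ⟨a, ha, hap⟩
  have := hα.mono
  obtain ⟨s, hs⟩ := exists_point_of_isAtomObject (hα.countable _) hD ha (a.arrow ≫ α.app _)
    ((hα.exists_iff _).1 ⟨a.arrow, rfl⟩)
  have h1 (φ) : φ ∈ p ↔ (mapSub M φ).Factors (s ≫ a.arrow ≫ α.app _) := by
    rw [hap, ← Category.assoc, ← hα.mapSub_factors hD hpt]
    constructor
    · intro h
      have h2 : (Subobject.pullback a.arrow).obj (mapSub N φ) = ⊤ := by
        refine ha.eq_top fun hn => h ?_
        rw [inf_comm]
        exact fun t => pullback_arrow_le_iff.1 (hn _)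
      rw [← pullback_factors, h2]
      exact factors_top s
    · intro h hn
      exact IsAtomObject.not_isNull hD (.of_factors hn
        ((Subobject.inf_factors _).2 ⟨h, Subobject.factors_comp_arrow s⟩))
  obtain ⟨Z, v, k, hk, f, r, hr, hrs⟩ := hs
  refine hq.omits X Z k f (hpt.imageSubobject_mem hr) p hp fun φ => ?_
  rw [h1, ← hrs, hpt.mapSub_factors_iff hr]

end PointModel

end PosModel

theorem mainTheorem5
    {C : Type u₁} [Category.{v₁} C] [PosModel.CoherentCategory C] [CountableCategory C]
    (F : PosModel.Filtration C)
    (hF : ∀ s ∈ F.sorts, EffectiveEpi (terminal.from s))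
    {D : Type u₂} [Category.{v₂} D] [PosModel.AlephOneGeometricCategory D]
    (hD : PosModel.IsTwoValued D)
    {I : Type w} [Countable I] (σ : I → C) (hσ : ∀ i, σ i ∈ F.sorts)
    (hσ' : ∀ s ∈ F.sorts, {i | σ i = s}.Infinite)
    (E : ∀ X : Finset I, Set (PosModel.TypeSpace (PosModel.finProd σ X)))
    (hE : ∀ X, IsMeagre (E X)) :
    ∃ A : Set (PosModel.OmegaType σ), A ∈ residual (PosModel.OmegaType σ) ∧
      ∀ q ∈ A, ∀ (M : C ⥤ D) [PosModel.CoherentFunctor M],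
        PosModel.StronglyRealizesOmega M q →
          ∃ (N : C ⥤ D) (_ : PosModel.CoherentFunctor N) (α : N ⟶ M),
            (∀ x, Mono (α.app x)) ∧ PosModel.PositivelyClosed N ∧
              ∀ X, ∀ p ∈ E X, PosModel.WeaklyOmits N p := by
  refine ⟨_, PosModel.residual_isGeneric (fun i => hF _ (hσ i)) (fun i => hσ' _ (hσ i)) E hE,
    fun q hq M hM hqM => ?_⟩
  obtain ⟨pt, hpt⟩ := hq.exists_isPointRealization hD hqM
  obtain ⟨N, α, hα⟩ := PosModel.exists_isPointModel pt
  have hN := PosModel.IsPointModel.coherentFunctor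
    (@PosModel.CoherentFunctor.map_union _ _ _ _ M hM)
    hα hD hpt hq F fun s hs => (hσ' s hs).nonempty
  exact ⟨N, hN, α, hα.mono, hα.positivelyClosed hD hpt hq,
    fun X p hp => hα.weaklyOmits hD hpt hq X hp⟩
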